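/- **Setting.** Let $Q$ be a finite quiver with vertex set $Q_0$ and arrow set $Q_1$ (an arrow $a$ goes from $ta$ to $ha$), let $\alpha,\zeta\in\mathbb{Z}_{\ge 0}^{Q_0}$, and let $\Bbbk$ be an arbitrary field. Varieties over $\Bbbk$ are described by their $K$-points for a field extension $K/\Bbbk$, with the Zariski topology and the $K$-valued regular functions defined over $\Bbbk$; the extension $K/\Bbbk$ is arbitrary (e.g. $K=\Bbbk$, or $K=\overline{\Bbbk}$). A subvariety carries the induced structure; a quotient carries the quotient topology, and its regular functions are those whose pullback is regular. A framed representation is a pair $(M,f)$ consisting of linear maps $M_a:K^{\alpha_{ta}}\to K^{\alpha_{ha}}$ ($a\in Q_1$) and $f_i:K^{\alpha_i}\to K^{\zeta_i}$ ($i\in Q_0$). The group $GL(\alpha)=\prod_i GL_{\alpha_i}$ acts by $g\cdot(M,f)=\big((g_{ha}M_ag_{ta}^{-1})_a,(f_ig_i^{-1})_i\big)$. The pair $(M,f)$ is stable if no nonzero subrepresentation $N$ of $M$ satisfies $N_i\subseteq\ker f_i$ for all $i$. Let $\mathrm{Rep}^s(Q,\alpha,\zeta)$ be the variety of stable pairs,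 let $\mathcal{M}^s(Q,\alpha,\zeta)$ be its quotient by $GL(\alpha)$, whose points are the $GL(\alpha)$-orbits, and let $\pi$ be the quotient map. Let $Q^\zeta$ be $Q$ with an additional vertex $\infty$ and, for each $i\in Q_0$, arrows $f_{i1},\dots,f_{i\zeta_i}$ from $i$ to $\infty$. The paths of nonzero length in $Q^\zeta$ ending in $\infty$ are the $f_{jq}\tau$, with $\tau$ a path of $Q$ ending in $j$. (In a product of paths the right factor comes first.) Let $J_i$ be the space of families of scalars indexed by the paths $f_{jq}\tau$ starting at $i$; each such path is the corresponding coordinate function on $J_i$. Let $\varphi_i:K^{\alpha_i}\to J_i$ be the map whose component at $f_{jq}\tau$ is the $q$-th component of $f_jM_\tau$. A $J$-skeleton of a stable pair $(M,f)$ is a set $\mathfrak{S}$ of paths $f_{jq}\tau$ such that (a) for every $i\in Q_0$ the restrictions to $\varphi_i(K^{\alpha_i})$ of the paths in $\mathfrak{S}$ starting at $i$ form a basis of $\varphi_i(K^{\alpha_i})^*$; (b) if $\sigma$ is a path $f_{jq}\tau$ starting at $ha$ for an arrow $a\in Q_1$, and $\sigma a\in\mathfrak{S}$, then $\sigma\in\mathfrak{S}$.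 Below, "$J$-skeleton" means a $J$-skeleton of some stable pair with the dimension vectors $\alpha,\zeta$; let $X(\mathfrak{S})\subseteq\mathrm{Rep}^s(Q,\alpha,\zeta)$ be the set of the stable pairs with $J$-skeleton $\mathfrak{S}$. Let $\Gamma$ be the set of all paths occurring in $J$-skeleta, $\widetilde\Gamma=\Gamma\cup\{\tau a\mid\tau\in\Gamma,\ a\in Q_1,\ \tau\text{ starts at }ha\}$, $\widetilde\Gamma_i$ the set of paths in $\widetilde\Gamma$ starting at $i$, and $\widehat J_i=K^{\widetilde\Gamma_i}$. Let $\mathrm{Grass}_\alpha(\widehat J)=\prod_{i\in Q_0}\mathrm{Grass}_{\alpha_i}(\widehat J_i)$ be the product of the Grassmannians of $\alpha_i$-dimensional subspaces, the quotient by $GL(\alpha)$ of the variety of families of injective linear maps $K^{\alpha_i}\to\widehat J_i$. Let $\widehat\varphi_i:K^{\alpha_i}\to\widehat J_i$ consist of the components of $\varphi_i$ at the paths in $\widetilde\Gamma_i$. **Theorem.** (1) There are only finitely many $J$-skeleta $\mathfrak{S}$, and $$\mathrm{Rep}^s(Q,\alpha,\zeta)=\bigcup_{\mathfrak{S}}X(\mathfrak{S}),\qquad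 \mathcal{M}^s(Q,\alpha,\zeta)=\bigcup_{\mathfrak{S}}\pi(X(\mathfrak{S})).$$ There is an integer $N\ge 0$ such that for every $J$-skeleton $\mathfrak{S}$ the sets $X(\mathfrak{S})\subseteq\mathrm{Rep}^s(Q,\alpha,\zeta)$ and $\pi(X(\mathfrak{S}))\subseteq\mathcal{M}^s(Q,\alpha,\zeta)$ are Zariski open, and there are isomorphisms of varieties $X(\mathfrak{S})\cong GL(\alpha)\times\mathbb{A}^N$, equivariant for the action of $GL(\alpha)$ on the first factor by left multiplication, and $\pi(X(\mathfrak{S}))\cong\mathbb{A}^N$, under which the restriction of $\pi$ to $X(\mathfrak{S})$ is the projection onto the second factor. In particular $\mathcal{M}^s(Q,\alpha,\zeta)$ is covered by finitely many open subspaces isomorphic to affine spaces. (2) The map sending the orbit of $(M,f)$ to $(\operatorname{im}\widehat\varphi_i)_{i\in Q_0}$ is an isomorphism of $\mathcal{M}^s(Q,\alpha,\zeta)$ onto a locally closed subvariety of $\mathrm{Grass}_\alpha(\widehat J)$. -/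

import Mathlib

open Set
open scoped Topology

universe u v w h x y z

noncomputable section

/-! ### Varieties as spaces with functions

Let `K / k` be an extension of fields. A variety over `k` is described by its set `X` of `K`-points,
its `k`-Zariski topology, and the sheaf of `k`-algebras of `K`-valued regular functions defined
over `k`. For `K = k` these are the classical notions on `k`-points; for `K` an algebraic closure
of `k` they capture (reduced) varieties over the possibly non-closed field `k`. -/

/-- A space with functions: a topology on `X` and, on every open set `U`, the `k`-algebra of regular
functions on `U` with values in `K`. A function on `U` is represented by any of its extensions
to `X`; the values off `U` are irrelevant by `reg_congr`. The other laws are those of a sheaf. -/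
structure FunSpace (k : Type u) (K : Type v) [Field k] [Field K] [Algebra k K] (X : Type x)
    extends TopologicalSpace X where
  reg : Set X → Subalgebra k (X → K)
  reg_congr : ∀ {U : Set X} {f g : X → K}, EqOn f g U → f ∈ reg U → g ∈ reg U
  reg_mono : ∀ {U W : Set X} {f : X → K}, IsOpen U → IsOpen W → W ⊆ U → f ∈ reg U → f ∈ reg W
  reg_local : ∀ {U : Set X} {f : X → K}, IsOpen U →
    (∀ a ∈ U, ∃ W, IsOpen W ∧ a ∈ W ∧ W ⊆ U ∧ f ∈ reg W) → f ∈ reg U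

namespace FunSpace

variable {k : Type u} {K : Type v} [Field k] [Field K] [Algebra k K]
  {X : Type x} {Y : Type y} {Z : Type z}

variable (k K) in
/-- Affine space with coordinates indexed by `ι`: the topology is generated by the nonvanishing loci
of polynomials over `k`, and a function is regular if it is locally a quotient of two such
polynomials. -/
def affine (ι : Type x) : FunSpace k K (ι → K) :=
  letI top : TopologicalSpace (ι → K) := TopologicalSpace.generateFrom
    (range fun q : MvPolynomial ι k => {a : ι → K | MvPolynomial.aeval a q ≠ 0})
  { toTopologicalSpace := top
    reg := fun U =>
      { carrier := {f | ∀ a ∈ U, ∃ W : Set (ι → K), IsOpen W ∧ a ∈ W ∧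
          ∃ p q : MvPolynomial ι k, ∀ b ∈ U ∩ W, MvPolynomial.aeval b q ≠ 0 ∧
            f b = MvPolynomial.aeval b p / MvPolynomial.aeval b q}
        mul_mem' := by
          intro f g hf hg a ha
          obtain ⟨W, hW, haW, p, q, h1⟩ := hf a ha
          obtain ⟨W', hW', haW', p', q', h2⟩ := hg a ha
          refine ⟨W ∩ W', hW.inter hW', ⟨haW, haW'⟩, p * p', q * q', ?_⟩
          rintro b ⟨hb, hbW, hbW'⟩
          obtain ⟨n1, e1⟩ := h1 b ⟨hb, hbW⟩
          obtain ⟨n2, e2⟩ := h2 b ⟨hb, hbW'⟩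
          simp only [map_mul, Pi.mul_apply, e1, e2]
          exact ⟨mul_ne_zero n1 n2, by field_simp⟩
        add_mem' := by
          intro f g hf hg a ha
          obtain ⟨W, hW, haW, p, q, h1⟩ := hf a ha
          obtain ⟨W', hW', haW', p', q', h2⟩ := hg a ha
          refine ⟨W ∩ W', hW.inter hW', ⟨haW, haW'⟩, p * q' + p' * q, q * q', ?_⟩
          rintro b ⟨hb, hbW, hbW'⟩
          obtain ⟨n1, e1⟩ := h1 b ⟨hb, hbW⟩
          obtain ⟨n2, e2⟩ := h2 b ⟨hb, hbW'⟩
          simp only [map_mul, map_add, Pi.add_apply, e1, e2]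
          exact ⟨mul_ne_zero n1 n2, by field_simp⟩
        algebraMap_mem' := by
          intro c a _
          exact ⟨univ, isOpen_univ, mem_univ _, MvPolynomial.C c, 1, fun b _ => by simp⟩ }
    reg_congr := by
      intro U f g hfg hf a ha
      obtain ⟨W, hW, haW, p, q, h1⟩ := hf a ha
      exact ⟨W, hW, haW, p, q, fun b hb => ⟨(h1 b hb).1, (hfg hb.1) ▸ (h1 b hb).2⟩⟩
    reg_mono := by
      intro U W' f _ _ hWU hf a ha
      obtain ⟨W, hW, haW, p, q, h1⟩ := hf a (hWU ha)
      exact ⟨W, hW, haW, p, q, fun b hb => h1 b ⟨hWU hb.1, hb.2⟩⟩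
    reg_local := by
      intro U f _ hf a ha
      obtain ⟨W', hW', haW', _, hfW⟩ := hf a ha
      obtain ⟨W, hW, haW, p, q, h1⟩ := hfW a haW'
      exact ⟨W' ∩ W, IsOpen.inter hW' hW, ⟨haW', haW⟩, p, q, fun b hb => h1 b hb.2⟩ }

/-- The structure induced along `e : Y → X` (used for injective `e`, e.g. for the inclusion of
a locally closed subvariety): the induced topology, and the functions that are locally restrictions
of regular functions on open subsets of `X`. -/
def induced (S : FunSpace k K X) (e : Y → X) : FunSpace k K Y :=
  letI := S.toTopologicalSpace
  letI top : TopologicalSpace Y := TopologicalSpace.induced e S.toTopologicalSpace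
  { toTopologicalSpace := top
    reg := fun U =>
      { carrier := {f | ∀ a ∈ U, ∃ W : Set X, IsOpen W ∧ e a ∈ W ∧
          ∃ g ∈ S.reg W, ∀ b ∈ U, e b ∈ W → f b = g (e b)}
        mul_mem' := by
          intro f f' hf hf' a ha
          obtain ⟨W, hW, haW, g, hg, h1⟩ := hf a ha
          obtain ⟨W', hW', haW', g', hg', h2⟩ := hf' a ha
          have hI := hW.inter hW'
          refine ⟨W ∩ W', hI, ⟨haW, haW'⟩, g * g', mul_mem
            (S.reg_mono hW hI inter_subset_left hg) (S.reg_mono hW' hI inter_subset_right hg'), ?_⟩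
          intro b hb hbW
          simp [h1 b hb hbW.1, h2 b hb hbW.2]
        add_mem' := by
          intro f f' hf hf' a ha
          obtain ⟨W, hW, haW, g, hg, h1⟩ := hf a ha
          obtain ⟨W', hW', haW', g', hg', h2⟩ := hf' a ha
          have hI := hW.inter hW'
          refine ⟨W ∩ W', hI, ⟨haW, haW'⟩, g + g', add_mem
            (S.reg_mono hW hI inter_subset_left hg) (S.reg_mono hW' hI inter_subset_right hg'), ?_⟩
          intro b hb hbW
          simp [h1 b hb hbW.1, h2 b hb hbW.2]
        algebraMap_mem' := by
          intro c a _
          exact ⟨univ, isOpen_univ, mem_univ _, algebraMap k (X → K) c,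
            Subalgebra.algebraMap_mem _ _, fun b _ _ => rfl⟩ }
    reg_congr := by
      intro U f f' hff hf a ha
      obtain ⟨W, hW, haW, g, hg, h1⟩ := hf a ha
      exact ⟨W, hW, haW, g, hg, fun b hb hbW => (hff hb) ▸ h1 b hb hbW⟩
    reg_mono := by
      intro U W' f _ _ hWU hf a ha
      obtain ⟨W, hW, haW, g, hg, h1⟩ := hf a (hWU ha)
      exact ⟨W, hW, haW, g, hg, fun b hb => h1 b (hWU hb)⟩
    reg_local := by
      intro U f _ hf a ha
      obtain ⟨W', hW', haW', _, hfW⟩ := hf a ha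
      obtain ⟨O, hO, rfl⟩ := isOpen_induced_iff.mp hW'
      obtain ⟨W, hW, haW, g, hg, h1⟩ := hfW a haW'
      exact ⟨O ∩ W, hO.inter hW, ⟨haW', haW⟩, g,
        S.reg_mono hW (hO.inter hW) inter_subset_right hg, fun b _ hbW => h1 b hbW.1 hbW.2⟩ }

/-- The quotient structure along a surjection `π : X → Z`: a subset is open if and only if its
preimage is, and a function is regular if and only if its pullback is. If the fibers of `π` are the
orbits of a group this is the geometric quotient: regular functions are the invariant ones. -/
def quotient (S : FunSpace k K X) (π : X → Z) : FunSpace k K Z :=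
  letI := S.toTopologicalSpace
  letI top : TopologicalSpace Z := TopologicalSpace.coinduced π S.toTopologicalSpace
  { toTopologicalSpace := top
    reg := fun U =>
      { carrier := {f | f ∘ π ∈ S.reg (π ⁻¹' U)}
        mul_mem' := fun hf hg => (S.reg _).mul_mem hf hg
        add_mem' := fun hf hg => (S.reg _).add_mem hf hg
        algebraMap_mem' := fun c => (S.reg _).algebraMap_mem c }
    reg_congr := fun hfg hf => S.reg_congr (fun _ ha => hfg ha) hf
    reg_mono := fun hU hW hWU hf =>
      S.reg_mono (isOpen_coinduced.mp hU) (isOpen_coinduced.mp hW) (preimage_mono hWU) hf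
    reg_local := by
      intro U f hU hf
      refine S.reg_local (isOpen_coinduced.mp hU) fun a ha => ?_
      obtain ⟨W, hW, haW, hWU, h⟩ := hf (π a) ha
      exact ⟨π ⁻¹' W, isOpen_coinduced.mp hW, haW, preimage_mono hWU, h⟩ }

/-- The structure of a subvariety on a subset. -/
def sub (S : FunSpace k K X) (A : Set X) : FunSpace k K A := S.induced Subtype.val

/-- Morphisms: continuous maps along which regular functions pull back to regular functions. -/
def IsMorphism (S : FunSpace k K X) (T : FunSpace k K Y) (φ : X → Y) : Prop :=
  Continuous[S.toTopologicalSpace, T.toTopologicalSpace] φ ∧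
    ∀ U : Set Y, IsOpen[T.toTopologicalSpace] U → ∀ f ∈ T.reg U, f ∘ φ ∈ S.reg (φ ⁻¹' U)

/-- Isomorphisms: bijections that are morphisms in both directions. -/
def IsIso (S : FunSpace k K X) (T : FunSpace k K Y) (e : X ≃ Y) : Prop :=
  IsMorphism S T e ∧ IsMorphism T S e.symm

end FunSpace

/-! ### Framed representations -/

section Framed

variable {V : Type w} [Quiver.{h} V]

/-- A framed representation over `K` with dimension vectors `α` and `ζ`: matrices `M_a` of the arrows
and matrices `f_i : K ^ α i → K ^ ζ i`. -/
@[ext]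
structure FramedRep (K : Type v) (α ζ : V → ℕ) where
  map : ∀ ⦃i j : V⦄, (i ⟶ j) → Matrix (Fin (α j)) (Fin (α i)) K
  frame : ∀ i : V, Matrix (Fin (ζ i)) (Fin (α i)) K

/-- The group `GL(α)`, the product of the groups `GL (α i)`. -/
abbrev GLα (K : Type v) [Field K] (α : V → ℕ) : Type (max w v) :=
  ∀ i : V, Matrix.GeneralLinearGroup (Fin (α i)) K

/-- A path of nonzero length from `i` to `∞` in the extended quiver `Q^ζ`. As no arrow leaves `∞`,
it is `f_{j q} τ` for a path `τ` of `Q` from `i` to some vertex `j`, and an arrow `f_{j q}`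
from `j` to `∞`, where `q` is one of `1, …, ζ j`. -/
structure FramedPath (ζ : V → ℕ) (i : V) where
  target : V
  path : Quiver.Path i target
  row : Fin (ζ target)

/-- The path `σ a`: first the arrow `a`, then the path `σ`. -/
def FramedPath.comp {ζ : V → ℕ} {i l : V} (σ : FramedPath ζ i) (a : l ⟶ i) : FramedPath ζ l :=
  ⟨σ.target, (Quiver.Hom.toPath a).comp σ.path, σ.row⟩

variable {K : Type v} [Field K] {α ζ : V → ℕ}

/-- `g • (M, f) = (g_{ha} M_a g_{ta}⁻¹, f_i g_i⁻¹)`. -/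
instance : MulAction (GLα K α) (FramedRep K α ζ) where
  smul g p :=
    { map := fun i j a => (g j).1 * p.map a * (g i)⁻¹.1
      frame := fun i => p.frame i * (g i)⁻¹.1 }
  one_smul p := by
    apply FramedRep.ext
    · funext i j a
      change (1 : Matrix _ _ K) * p.map a * ((1 : Matrix.GeneralLinearGroup _ K)⁻¹).1 = _
      simp
    · funext i
      change p.frame i * ((1 : Matrix.GeneralLinearGroup _ K)⁻¹).1 = _
      simp
  mul_smul g g' p := by
    apply FramedRep.ext
    · funext i j a
      change ((g j) * (g' j)).1 * p.map a * ((g i * g' i)⁻¹).1 =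
        (g j).1 * ((g' j).1 * p.map a * (g' i)⁻¹.1) * (g i)⁻¹.1
      rw [mul_inv_rev, Units.val_mul, Units.val_mul]
      simp only [Matrix.mul_assoc]
    · funext i
      change p.frame i * ((g i * g' i)⁻¹).1 = (p.frame i * (g' i)⁻¹.1) * (g i)⁻¹.1
      rw [mul_inv_rev, Units.val_mul, Matrix.mul_assoc]

namespace FramedRep

/-- Stability: a subrepresentation `N` with `N_i ⊆ ker f_i` for all `i` is zero. -/
def Stable (p : FramedRep K α ζ) : Prop :=
  ∀ N : ∀ i : V, Submodule K (Fin (α i) → K),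
    (∀ ⦃i j : V⦄ (a : i ⟶ j), ∀ m ∈ N i, (p.map a).mulVec m ∈ N j) →
    (∀ i, ∀ m ∈ N i, (p.frame i).mulVec m = 0) → ∀ i, N i = ⊥

/-- The action of a path. -/
def pathMap (p : FramedRep K α ζ) {i : V} :
    ∀ {j : V}, Quiver.Path i j → Matrix (Fin (α j)) (Fin (α i)) K
  | _, Quiver.Path.nil => 1
  | _, Quiver.Path.cons τ a => p.map a * p.pathMap τ

/-- The component `φ_i : M_i → J_i` of the canonical map. Here `J_i` is the product of copies of
`K ^ ζ j` over the paths `τ : i ⇝ j`, i.e. the space of families of scalars indexed by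
the paths `f_{j q} τ`, and `φ_i m = (f_j (τ m))_τ`. -/
def phi (p : FramedRep K α ζ) (i : V) : (Fin (α i) → K) →ₗ[K] (FramedPath ζ i → K) :=
  LinearMap.pi fun σ => LinearMap.proj σ.row ∘ₗ
    (p.frame σ.target).mulVecLin ∘ₗ (p.pathMap σ.path).mulVecLin

/-- The restriction to the image of `φ_i` of the path `σ`, viewed as a linear function on `J_i`. -/
def pathRestr (p : FramedRep K α ζ) {i : V} (σ : FramedPath ζ i) :
    Module.Dual K (LinearMap.range (p.phi i)) :=
  (LinearMap.proj (R := K) (φ := fun _ : FramedPath ζ i => K) σ).domRestrict _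

/-- `𝔖` is a `J`-skeleton of the stable pair `p`; `𝔖 i` is the set of the paths in `𝔖` that start
at `i`. The dual of the image of the canonical map is graded by the vertices of `Q^ζ`, with `e_∞`
a basis of the component at `∞`, so that the basis condition is one for each vertex of `Q`. -/
structure HasSkeleton (p : FramedRep K α ζ) (𝔖 : ∀ i : V, Set (FramedPath ζ i)) : Prop where
  stable : p.Stable
  linearIndependent : ∀ i, LinearIndependent K fun σ : 𝔖 i => p.pathRestr σ.1
  span_eq_top : ∀ i, Submodule.span K (range fun σ : 𝔖 i => p.pathRestr σ.1) = ⊤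
  closed : ∀ ⦃i l : V⦄ (σ : FramedPath ζ i) (a : l ⟶ i), σ.comp a ∈ 𝔖 l → σ ∈ 𝔖 i

end FramedRep

variable (K α ζ) in
/-- The `J`-skeleta with dimension vector `α`. -/
def skeleta : Set (∀ i : V, Set (FramedPath ζ i)) :=
  {𝔖 | ∃ p : FramedRep K α ζ, p.HasSkeleton 𝔖}

/-! ### The varieties -/

variable (K α ζ) in
/-- The set of stable framed representations. -/
abbrev StableRep : Type (max v w h) := {p : FramedRep K α ζ // p.Stable}

/-- The chart `X(𝔖)` of stable pairs with `J`-skeleton `𝔖`. -/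
def chart (𝔖 : ∀ i : V, Set (FramedPath ζ i)) : Set (StableRep K α ζ) :=
  {p | p.1.HasSkeleton 𝔖}

/-- The matrix entries of a framed representation. -/
def FramedRep.coord (p : FramedRep K α ζ) :
    ((Σ i j : V, (i ⟶ j) × Fin (α j) × Fin (α i)) ⊕ (Σ i : V, Fin (ζ i) × Fin (α i))) → K
  | Sum.inl ⟨_, _, a, r, c⟩ => p.map a r c
  | Sum.inr ⟨i, r, c⟩ => p.frame i r c

variable (K α ζ) in
/-- The set of points of the moduli space: the `GL(α)`-orbits of stable framed representations. -/
abbrev Moduli : Type (max v w h) :=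
  Quotient ((MulAction.orbitRel (GLα K α) (FramedRep K α ζ)).comap
    (Subtype.val : StableRep K α ζ → FramedRep K α ζ))

variable (K α ζ) in
/-- The quotient map. -/
def quotMap : StableRep K α ζ → Moduli K α ζ := Quotient.mk _

section Structures

variable (k : Type u) [Field k] [Algebra k K]

variable (K α ζ) in
/-- The variety of stable framed representations, a subvariety of the affine space of matrix
entries. -/
def stableSpace : FunSpace k K (StableRep K α ζ) :=
  (FunSpace.affine k K _).induced fun p => p.1.coord

variable (K α ζ) in
/-- The moduli space, the quotient of the variety of stable framed representations. -/
def moduliSpace : FunSpace k K (Moduli K α ζ) :=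
  (stableSpace K α ζ k).quotient (quotMap K α ζ)

variable (K α) in
/-- The variety `GL(α) × 𝔸^N`, a subvariety of the affine space of matrix entries
and coordinates. -/
def glAffineSpace (N : ℕ) : FunSpace k K (GLα K α × (Fin N → K)) :=
  (FunSpace.affine k K ((Σ i : V, Fin (α i) × Fin (α i)) ⊕ Fin N)).induced fun x =>
    Sum.elim (fun c => (x.1 c.1).1 c.2.1 c.2.2) x.2

end Structures

/-! ### Products of Grassmannians -/

section Grassmannian

variable (W : V → Type x)

variable (K α) in
/-- Families of injective linear maps `K ^ α i → K ^ W i`, as matrices. -/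
abbrev IHom : Type (max v w x) :=
  ∀ i : V, {B : Matrix (W i) (Fin (α i)) K // Function.Injective B.mulVecLin}

variable (K α) in
/-- The product of the Grassmannians of `α i`-dimensional subspaces of `K ^ W i`. -/
abbrev Grass : Type (max v w x) :=
  ∀ i : V, {U : Submodule K (W i → K) // Module.rank K U = α i}

variable (K α) in
/-- The quotient map `IHom → Grass` that sends a family of injective maps to their images. -/
def IHom.toGrass (B : IHom K α W) : Grass K α W := fun i =>
  ⟨LinearMap.range (B i).1.mulVecLin, by
    have h := lift_rank_range_of_injective _ (B i).2
    simpa using h⟩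

variable (K α) in
/-- The variety structure on the product of Grassmannians: it is the quotient of the variety
of families of injective matrices by `GL(α)`, the fibers being the sets of bases. -/
def grassSpace (k : Type u) [Field k] [Algebra k K] : FunSpace k K (Grass K α W) :=
  ((FunSpace.affine k K (Σ i : V, W i × Fin (α i))).induced
    fun (B : IHom K α W) c => (B c.1).1 c.2.1 c.2.2).quotient (IHom.toGrass K α W)

end Grassmannian

variable (K α ζ) in
/-- The set `Γ(α)` of paths (starting at `i`) that occur in `J`-skeleta. -/
def skelPaths (i : V) : Set (FramedPath ζ i) := {σ | ∃ 𝔖 ∈ skeleta K α ζ, σ ∈ 𝔖 i}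

variable (K α ζ) in
/-- The set of paths `σ` and `τ a` (starting at `i`), for `σ, τ` in `Γ(α)` and `a` an arrow. -/
def extPaths (i : V) : Set (FramedPath ζ i) :=
  skelPaths K α ζ i ∪ {σ | ∃ (l : V) (a : i ⟶ l), ∃ τ ∈ skelPaths K α ζ l, σ = τ.comp a}

/-- The truncated canonical map from `M_i` to `Ĵ_i = K ^ (extPaths i)`. -/
def FramedRep.phiHat (p : FramedRep K α ζ) (i : V) :
    (Fin (α i) → K) →ₗ[K] (extPaths K α ζ i → K) :=
  LinearMap.funLeft K K Subtype.val ∘ₗ p.phi i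

end Framed

end

/-!
The framed path `σ = f_{j q} τ` starting at `i` acts on a framed representation `p` as a linear
form on `K ^ α i`, written as a row vector `p.row σ`. The rows are the components of `φ_i`, and
`p` is stable if and only if all `φ_i` are injective (`FramedRep.stable_iff_injective_phi`), in
which case the dual of the image of `φ_i` is identified with the space of row vectors. Hence a
`J`-skeleton of `p` is a set of paths, closed under removing initial arrows, whose rows form a
basis of the row vectors at each vertex; stability is then automatic
(`FramedRep.hasSkeleton_iff`). A closed set of paths whose rows for a stable `p` are independent
extends to a skeleton of `p` (`FramedRep.Stable.exists_hasSkeleton`), so the charts cover. The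
final pieces of a path in a skeleton belong to the skeleton as well, which bounds the length of
the path, so that there are finitely many skeleta (`finite_skeleta`).

Fix a skeleton `S`. Its chart is the open set of the `p` whose square matrices `A` of rows at `S`
are invertible, and `A • p` is in normal form: its rows at `S` are unit vectors. The matrix
entries of a representation in normal form are the entries of the rows of the paths `f_{i q}` and
`τ a` with `τ` in `S`. Those of these paths that belong to `S` have unit vectors as rows, and the
rows of the others, which form the border of `S`, can be prescribed arbitrarily: by induction on
the length of the paths, closedness of `S` ensures that the representation so constructed has unit
vectors as rows at `S` (`EnumSkeleton.row_ofRows`). This identifies the chart with `GL(α) × 𝔸^N`,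
and `N` does not depend on `S` because every path in `S` is one of the `f_{i q}` or `τ a`, and
they are all different (`EnumSkeleton.card_index`).

For the embedding into the product of Grassmannians, let a family of matrices `B` with rows
indexed by `Γ̃` have an invertible minor at `S`. Normalizing `B` and reading off its rows at the
border of `S` gives coordinates of a representation in normal form. Thus the open subset of the
product of Grassmannians where the minor at `S` is nonzero is mapped to the moduli space by a
morphism that is a retraction of the embedding (`EnumSkeleton.retraction_moduliToGrass`). The only
paths of the border that may be missing in `Γ̃` are paths `f_{i q}` that do not occur in any
skeleton, and they vanish on all stable representations (`row_base_eq_zero`). The points of the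
open subset that are in the image are those that agree with the image of their retraction, which
is a closed condition (`EnumSkeleton.toGrass_mem_range_iff`). So the image is locally closed, and
the retractions are the local inverses (`FunSpace.IsMorphism.isIso_sub`).

All maps are morphisms because their matrix entries are built from regular functions by ring
operations and inversion of nonvanishing determinants (`FunSpace.MatReg`).
-/

/-! ### Spaces with functions -/

noncomputable section

namespace FunSpace

variable {k : Type u} {K : Type v} [Field k] [Field K] [Algebra k K]
  {X : Type x} {Y : Type y} {Z : Type z}

/-- The non-vanishing locus of a regular function is open, and the function is invertible there.
For a sheaf of functions this says that the stalks are local rings whose maximal ideal consists of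
the germs vanishing at the point. -/
def IsLocal (S : FunSpace k K X) : Prop :=
  ∀ ⦃U : Set X⦄, IsOpen[S.toTopologicalSpace] U → ∀ f ∈ S.reg U,
    IsOpen[S.toTopologicalSpace] {a ∈ U | f a ≠ 0} ∧ f⁻¹ ∈ S.reg {a ∈ U | f a ≠ 0}

theorem isOpen_affine_ne_zero {ι : Type x} (q : MvPolynomial ι k) :
    IsOpen[(affine k K ι).toTopologicalSpace] {a : ι → K | MvPolynomial.aeval a q ≠ 0} :=
  TopologicalSpace.isOpen_generateFrom_of_mem ⟨q, rfl⟩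

theorem isOpen_of_forall_mem (S : FunSpace k K X) {U : Set X}
    (h : ∀ a ∈ U, ∃ W, IsOpen[S.toTopologicalSpace] W ∧ a ∈ W ∧ W ⊆ U) :
    IsOpen[S.toTopologicalSpace] U := by
  let := S.toTopologicalSpace
  rw [isOpen_iff_forall_mem_open]
  intro a ha
  obtain ⟨W, h1, h2, h3⟩ := h a ha
  exact ⟨W, h3, h1, h2⟩

theorem isLocal_affine (ι : Type x) : (affine k K ι).IsLocal := by
  let := (affine k K ι).toTopologicalSpace
  intro U hU f hf
  refine ⟨isOpen_of_forall_mem _ ?_, ?_⟩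
  · rintro a ⟨ha, hfa⟩
    obtain ⟨W, hW, haW, p, q, h1⟩ := hf a ha
    refine ⟨U ∩ W ∩ {b | MvPolynomial.aeval b p ≠ 0},
      (hU.inter hW).inter (isOpen_affine_ne_zero p), ⟨⟨ha, haW⟩, ?_⟩, ?_⟩
    · intro h0
      exact hfa (by rw [(h1 a ⟨ha, haW⟩).2, h0, zero_div])
    · rintro b ⟨hb, hp⟩
      exact ⟨hb.1, by rw [(h1 b hb).2]; exact div_ne_zero hp (h1 b hb).1⟩
  · rintro a ⟨ha, hfa⟩
    obtain ⟨W, hW, haW, p, q, h1⟩ := hf a ha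
    refine ⟨W, hW, haW, q, p, ?_⟩
    rintro b ⟨⟨hb, hfb⟩, hbW⟩
    obtain ⟨hq, e⟩ := h1 b ⟨hb, hbW⟩
    refine ⟨fun h0 => hfb (by rw [e, h0, zero_div]), ?_⟩
    rw [Pi.inv_apply, e, inv_div]

theorem IsLocal.induced {S : FunSpace k K X} (hS : S.IsLocal) (e : Y → X) :
    (S.induced e).IsLocal := by
  let tX := S.toTopologicalSpace
  let tY := (S.induced e).toTopologicalSpace
  have he : Continuous e := continuous_induced_dom
  intro U hU f hf
  refine ⟨isOpen_of_forall_mem _ ?_, ?_⟩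
  · rintro a ⟨ha, hfa⟩
    obtain ⟨W, hW, haW, g, hg, h1⟩ := hf a ha
    refine ⟨U ∩ e ⁻¹' {b ∈ W | g b ≠ 0}, hU.inter ((hS hW g hg).1.preimage he),
      ⟨ha, haW, by rwa [← h1 a ha haW]⟩, ?_⟩
    rintro b ⟨hb, hbW, hgb⟩
    exact ⟨hb, by rwa [h1 b hb hbW]⟩
  · rintro a ⟨ha, hfa⟩
    obtain ⟨W, hW, haW, g, hg, h1⟩ := hf a ha
    refine ⟨_, (hS hW g hg).1, ⟨haW, by rwa [← h1 a ha haW]⟩, _, (hS hW g hg).2, ?_⟩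
    rintro b ⟨hb, -⟩ ⟨hbW, -⟩
    rw [Pi.inv_apply, Pi.inv_apply, h1 b hb hbW]

theorem IsLocal.inv_mem {S : FunSpace k K X} (hS : S.IsLocal) {f : X → K} (hf : f ∈ S.reg univ)
    (h0 : ∀ a, f a ≠ 0) : f⁻¹ ∈ S.reg univ := by
  let := S.toTopologicalSpace
  have h := (hS isOpen_univ f hf).2
  rwa [show {a ∈ univ | f a ≠ 0} = (univ : Set X) by ext; simp [h0]] at h

theorem IsLocal.isOpen_ne_zero {S : FunSpace k K X} (hS : S.IsLocal) {f : X → K}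
    (hf : f ∈ S.reg univ) : IsOpen[S.toTopologicalSpace] {a | f a ≠ 0} := by
  let := S.toTopologicalSpace
  simpa using (hS isOpen_univ f hf).1

/-! ### Morphisms -/

theorem IsMorphism.comp {S : FunSpace k K X} {T : FunSpace k K Y} {R : FunSpace k K Z}
    {ψ : Y → Z} {φ : X → Y} (hψ : IsMorphism T R ψ) (hφ : IsMorphism S T φ) :
    IsMorphism S R (ψ ∘ φ) := by
  let := S.toTopologicalSpace
  let := T.toTopologicalSpace
  let := R.toTopologicalSpace
  exact ⟨hψ.1.comp hφ.1, fun U hU f hf => hφ.2 _ (hU.preimage hψ.1) _ (hψ.2 U hU f hf)⟩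

theorem IsMorphism.comp_mem {S : FunSpace k K X} {T : FunSpace k K Y} {φ : X → Y}
    (hφ : IsMorphism S T φ) {f : Y → K} (hf : f ∈ T.reg univ) : f ∘ φ ∈ S.reg univ := by
  let := T.toTopologicalSpace
  exact hφ.2 univ isOpen_univ f hf

theorem isMorphism_induced (S : FunSpace k K X) (e : Y → X) : IsMorphism (S.induced e) S e :=
  ⟨continuous_induced_dom, fun U hU f hf _ ha => ⟨U, hU, ha, f, hf, fun _ _ _ => rfl⟩⟩

/-- A map to a subvariety is a morphism if it is one as a map to the ambient variety. -/
theorem IsMorphism.codInduced {S : FunSpace k K X} {T : FunSpace k K Z} {e : Y → Z} {φ : X → Y}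
    (h : IsMorphism S T (e ∘ φ)) : IsMorphism S (T.induced e) φ := by
  let := S.toTopologicalSpace
  let := T.toTopologicalSpace
  let tY := (T.induced e).toTopologicalSpace
  have hc : Continuous φ := continuous_induced_rng.mpr h.1
  refine ⟨hc, fun U hU f hf => S.reg_local (hU.preimage hc) fun a ha => ?_⟩
  obtain ⟨W, hW, haW, g, hg, h1⟩ := hf (φ a) ha
  have hO := hW.preimage h.1
  have hI := (hU.preimage hc).inter hO
  refine ⟨_, hI, ⟨ha, haW⟩, inter_subset_left, ?_⟩
  exact S.reg_congr (fun b hb => (h1 (φ b) hb.1 hb.2).symm)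
    (S.reg_mono hO hI inter_subset_right (h.2 W hW g hg))

theorem isMorphism_quotient (S : FunSpace k K X) (π : X → Z) : IsMorphism S (S.quotient π) π :=
  ⟨continuous_coinduced_rng, fun _ _ _ hf => hf⟩

theorem IsMorphism.of_quotient {S : FunSpace k K X} {T : FunSpace k K Y} {π : X → Z} {φ : Z → Y}
    (h : IsMorphism S T (φ ∘ π)) : IsMorphism (S.quotient π) T φ := by
  let := S.toTopologicalSpace
  let := T.toTopologicalSpace
  exact ⟨continuous_coinduced_dom.mpr h.1, fun U hU f hf => h.2 U hU f hf⟩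

theorem aeval_mem_reg {S : FunSpace k K X} {ι : Type y} {φ : X → ι → K}
    (hφ : ∀ j, (fun a => φ a j) ∈ S.reg univ) (q : MvPolynomial ι k) :
    (fun a => MvPolynomial.aeval (φ a) q) ∈ S.reg univ := by
  induction q using MvPolynomial.induction_on with
  | C c =>
    simp only [MvPolynomial.aeval_C]
    exact (S.reg univ).algebraMap_mem c
  | add p q hp hq =>
    simp only [map_add]
    exact (S.reg univ).add_mem hp hq
  | mul_X p j hp =>
    simp only [map_mul, MvPolynomial.aeval_X]
    exact (S.reg univ).mul_mem hp (hφ j)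

theorem coord_mem_reg {ι : Type y} (j : ι) : (fun a => a j) ∈ (affine k K ι).reg univ := by
  intro a _
  exact ⟨univ, @isOpen_univ _ (affine k K ι).toTopologicalSpace, mem_univ _, MvPolynomial.X j, 1,
    fun b _ => by simp⟩

/-- A map to affine space is a morphism as soon as its coordinates are regular functions. -/
theorem IsLocal.isMorphism_affine {S : FunSpace k K X} (hS : S.IsLocal) {ι : Type y}
    {φ : X → ι → K} (hφ : ∀ j, (fun a => φ a j) ∈ S.reg univ) :
    IsMorphism S (affine k K ι) φ := by
  let := S.toTopologicalSpace
  let tA := (affine k K ι).toTopologicalSpace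
  have hc : Continuous φ := by
    refine continuous_generateFrom_iff.mpr ?_
    rintro _ ⟨q, rfl⟩
    exact hS.isOpen_ne_zero (aeval_mem_reg hφ q)
  refine ⟨hc, fun U hU f hf => S.reg_local (hU.preimage hc) fun a ha => ?_⟩
  obtain ⟨W, hW, haW, p, q, h1⟩ := hf (φ a) ha
  have hI := (hU.inter hW).preimage hc
  refine ⟨_, hI, ⟨ha, haW⟩, fun b hb => hb.1, ?_⟩
  have hq := hS isOpen_univ _ (aeval_mem_reg hφ q)
  refine S.reg_congr (f := (fun a => MvPolynomial.aeval (φ a) p) *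
    (fun a => MvPolynomial.aeval (φ a) q)⁻¹) ?_ ((S.reg _).mul_mem
      (S.reg_mono isOpen_univ hI (subset_univ _) (aeval_mem_reg hφ p))
      (S.reg_mono hq.1 hI (fun b hb => ⟨mem_univ _, (h1 _ hb).1⟩) hq.2))
  intro b hb
  simp only [Pi.mul_apply, Pi.inv_apply, Function.comp_apply, (h1 _ hb).2, div_eq_mul_inv]

theorem isOpen_image_val {S : FunSpace k K X} {A : Set X} (hA : IsOpen[S.toTopologicalSpace] A)
    {U : Set A} (hU : IsOpen[(S.sub A).toTopologicalSpace] U) :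
    IsOpen[S.toTopologicalSpace] (Subtype.val '' U) := by
  let := S.toTopologicalSpace
  exact hA.isOpenMap_subtype_val U hU

/-- A saturated open subset of a quotient is the quotient of its preimage. -/
theorem IsMorphism.of_quotient_sub {S : FunSpace k K X} {T : FunSpace k K Y} {π : X → Z}
    {B : Set Z} {A : Set X} (hA : IsOpen[S.toTopologicalSpace] A) (hAB : π ⁻¹' B = A) {φ : B → Y}
    (h : IsMorphism (S.sub A) T fun a => φ ⟨π a.1, (Set.ext_iff.mp hAB a.1).mpr a.2⟩) :
    IsMorphism ((S.quotient π).sub B) T φ := by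
  subst hAB
  let tX := S.toTopologicalSpace
  let tZ := (S.quotient π).toTopologicalSpace
  let tY := T.toTopologicalSpace
  have hB : IsOpen B := isOpen_coinduced.mpr hA
  have himg : ∀ U : Set Y, π ⁻¹' (Subtype.val '' (φ ⁻¹' U)) = Subtype.val ''
      ((fun a : π ⁻¹' B => φ ⟨π a.1, a.2⟩) ⁻¹' U) := by
    intro U
    ext a
    simp
  have hO : ∀ U : Set Y, IsOpen U → IsOpen (Subtype.val '' (φ ⁻¹' U)) := by
    intro U hU
    refine isOpen_coinduced.mpr ?_
    rw [himg U]
    exact isOpen_image_val hA (hU.preimage h.1)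
  refine ⟨?_, ?_⟩
  · refine continuous_def.mpr fun U hU => ?_
    exact isOpen_induced_iff.mpr ⟨_, hO U hU, preimage_image_eq _ Subtype.val_injective⟩
  · intro U hU f hf a ha
    classical
    refine ⟨_, hO U hU, ⟨a, ha, rfl⟩,
      fun z => if hz : z ∈ B then f (φ ⟨z, hz⟩) else 0, ?_, fun b _ _ => by simp⟩
    change _ ∈ S.reg (π ⁻¹' _)
    refine S.reg_local (isOpen_coinduced.mp (hO U hU)) ?_
    intro c hc
    rw [himg U] at hc
    obtain ⟨c, hc, rfl⟩ := hc
    obtain ⟨W, hW, hcW, g, hg, h1⟩ := h.2 U hU f hf c hc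
    have hI := hW.inter (isOpen_coinduced.mp (hO U hU))
    refine ⟨_, hI, ⟨hcW, by rw [himg U]; exact ⟨c, hc, rfl⟩⟩, inter_subset_right, ?_⟩
    refine S.reg_congr ?_ (S.reg_mono hW hI inter_subset_left hg)
    rintro b ⟨hbW, hb⟩
    rw [himg U] at hb
    obtain ⟨b, hb, rfl⟩ := hb
    have := h1 b hb hbW
    have hbB : π b.1 ∈ B := b.2
    simp only [Function.comp_apply] at this ⊢
    rw [dif_pos hbB, this]

/-- A morphism that has local retractions, defined on open subsets of the target that cover its
image, is an isomorphism onto its image. -/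
theorem IsMorphism.isIso_sub {S : FunSpace k K X} {T : FunSpace k K Y} {Y₀ : Set Y} (e : X ≃ Y₀)
    (he : IsMorphism S T fun a => (e a).1) {ι : Type z} (U : ι → Set Y)
    (hU : ∀ s, IsOpen[T.toTopologicalSpace] (U s)) (hcov : ∀ a, ∃ s, (e a).1 ∈ U s)
    (r : ∀ s, U s → X) (hr : ∀ s, IsMorphism (T.sub (U s)) S (r s))
    (hre : ∀ s a (ha : (e a).1 ∈ U s), r s ⟨_, ha⟩ = a) : S.IsIso (T.sub Y₀) e := by
  let tX := S.toTopologicalSpace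
  let tY := T.toTopologicalSpace
  let t0 := (T.sub Y₀).toTopologicalSpace
  have hsymm : ∀ (s : ι) (b : Y₀) (hb : b.1 ∈ U s), e.symm b = r s ⟨b.1, hb⟩ := by
    intro s b hb
    obtain ⟨a, rfl⟩ := e.surjective b
    rw [e.symm_apply_apply, hre]
  have hv : Continuous (Subtype.val : Y₀ → Y) := continuous_induced_dom
  have hpre : ∀ (s : ι) (O : Set X), IsOpen O → IsOpen (Subtype.val '' (r s ⁻¹' O)) :=
    fun s O hO => isOpen_image_val (hU s) (hO.preimage (hr s).1)
  refine ⟨he.codInduced, ?_, ?_⟩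
  · refine continuous_def.mpr fun O hO => isOpen_of_forall_mem (T.sub Y₀) ?_
    intro b hb
    obtain ⟨s, hs⟩ := hcov (e.symm b)
    rw [e.apply_symm_apply] at hs
    refine ⟨_, (hpre s O hO).preimage hv, ⟨⟨b.1, hs⟩, ?_, rfl⟩, ?_⟩
    · rw [mem_preimage, ← hsymm s b hs]
      exact hb
    · rintro c ⟨c', hc', h2⟩
      obtain ⟨y, hy⟩ := c'
      subst h2
      rw [mem_preimage, hsymm s c hy]
      exact hc'
  · intro O hO f hf b hb
    obtain ⟨s, hs⟩ := hcov (e.symm b)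
    rw [e.apply_symm_apply] at hs
    have hb' : (⟨b.1, hs⟩ : U s) ∈ r s ⁻¹' O := by
      rw [mem_preimage, ← hsymm s b hs]
      exact hb
    obtain ⟨W, hW, hbW, g, hg, h1⟩ := (hr s).2 O hO f hf ⟨b.1, hs⟩ hb'
    have hI := hW.inter (hU s)
    refine ⟨_, hI, ⟨hbW, hs⟩, g, T.reg_mono hW hI inter_subset_left hg, ?_⟩
    rintro c hc ⟨hcW, hcU⟩
    have hc' : (⟨c.1, hcU⟩ : U s) ∈ r s ⁻¹' O := by
      rw [mem_preimage, ← hsymm s c hcU]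
      exact hc
    have := h1 ⟨c.1, hcU⟩ hc' hcW
    simp only [Function.comp_apply] at this ⊢
    rw [hsymm s c hcU, this]

theorem isLocallyClosed_of_cover {T : FunSpace k K Y} {Y₀ : Set Y} {ι : Type z} (U : ι → Set Y)
    (hU : ∀ s, IsOpen[T.toTopologicalSpace] (U s)) (hcov : ∀ b ∈ Y₀, ∃ s, b ∈ U s)
    (hd : ∀ s, IsOpen[T.toTopologicalSpace] (U s \ Y₀)) :
    @IsLocallyClosed _ T.toTopologicalSpace Y₀ := by
  let tY := T.toTopologicalSpace
  refine ⟨⋃ s, U s, (⋃ s, U s \ Y₀)ᶜ, isOpen_iUnion hU,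
    (isOpen_iUnion hd).isClosed_compl, ?_⟩
  ext b
  simp only [mem_inter_iff, mem_iUnion, mem_compl_iff, mem_sdiff, not_exists, not_and, not_not]
  exact ⟨fun hb => ⟨hcov b hb, fun _ _ => hb⟩, fun ⟨⟨s, hs⟩, h⟩ => h s hs⟩

/-! ### Matrices of regular functions -/

/-- A map to matrices whose entries are regular functions. -/
def MatReg (S : FunSpace k K X) {m : Type y} {n : Type z} (M : X → Matrix m n K) : Prop :=
  ∀ i j, (fun a => M a i j) ∈ S.reg univ

theorem MatReg.mul {S : FunSpace k K X} {l : Type*} {m : Type*} {n : Type*} [Fintype m]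
    {M : X → Matrix l m K} {N : X → Matrix m n K} (hM : S.MatReg M) (hN : S.MatReg N) :
    S.MatReg fun a => M a * N a := by
  intro i j
  have : (fun a => (M a * N a) i j) = ∑ c, (fun a => M a i c) * fun a => N a c j := by
    ext a
    simp [Matrix.mul_apply]
  rw [this]
  exact sum_mem fun c _ => mul_mem (hM i c) (hN c j)

theorem matReg_const {S : FunSpace k K X} {m : Type y} {n : Type z} {M : Matrix m n K}
    (h : ∀ i j, M i j ∈ (algebraMap k K).range) : S.MatReg fun _ : X => M := by
  intro i j
  obtain ⟨c, hc⟩ := h i j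
  rw [show (fun _ : X => M i j) = algebraMap k (X → K) c by ext; simp [← hc]]
  exact Subalgebra.algebraMap_mem _ _

theorem matReg_one {S : FunSpace k K X} {n : Type y} [DecidableEq n] :
    S.MatReg fun _ : X => (1 : Matrix n n K) := by
  refine matReg_const fun i j => ?_
  rw [Matrix.one_apply]
  split_ifs
  exacts [one_mem _, zero_mem _]

theorem MatReg.det {S : FunSpace k K X} {n : Type y} [DecidableEq n] [Fintype n]
    {M : X → Matrix n n K} (hM : S.MatReg M) : (fun a => (M a).det) ∈ S.reg univ := by
  have : (fun a => (M a).det) =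
      ∑ σ : Equiv.Perm n, (Equiv.Perm.sign σ : ℤ) • ∏ i, fun a => M a (σ i) i := by
    ext a
    simp [Matrix.det_apply, Units.smul_def]
  rw [this]
  exact sum_mem fun σ _ => zsmul_mem (prod_mem fun i _ => hM _ _) _

theorem MatReg.inv {S : FunSpace k K X} (hS : S.IsLocal) {n : Type y} [DecidableEq n] [Fintype n]
    {M : X → Matrix n n K} (hM : S.MatReg M) (h0 : ∀ a, (M a).det ≠ 0) :
    S.MatReg fun a => (M a)⁻¹ := by
  intro i j
  have : (fun a => (M a)⁻¹ i j) =
      (fun a => (M a).det)⁻¹ * fun a => ((M a).updateRow j (Pi.single i 1)).det := by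
    ext a
    simp [Matrix.inv_def, Matrix.adjugate_apply, Ring.inverse_eq_inv']
  rw [this]
  refine mul_mem (hS.inv_mem hM.det h0) (MatReg.det fun r c => ?_)
  by_cases hr : r = j
  · subst hr
    simp only [Matrix.updateRow_self]
    by_cases hc : c = i
    · subst hc
      simp only [Pi.single_eq_same]
      exact one_mem _
    · simp only [ne_eq, hc, not_false_eq_true, Pi.single_eq_of_ne]
      exact zero_mem _
  · simp only [ne_eq, hr, not_false_eq_true, Matrix.updateRow_ne]
    exact hM r c

theorem MatReg.comp {S : FunSpace k K X} {T : FunSpace k K Y} {m n : Type*}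
    {M : Y → Matrix m n K} (hM : T.MatReg M) {φ : X → Y} (hφ : IsMorphism S T φ) :
    S.MatReg fun a => M (φ a) :=
  fun i j => hφ.comp_mem (hM i j)

end FunSpace

end

/-! ### Paths and rows -/

noncomputable section

namespace FramedPath

variable {V : Type w} [Quiver.{h} V] {ζ : V → ℕ}

/-- The path `f_{i q}` of length one. -/
def base (i : V) (q : Fin (ζ i)) : FramedPath ζ i := ⟨i, Quiver.Path.nil, q⟩

/-- The length of the underlying path of `Q`. -/
def length {i : V} (σ : FramedPath ζ i) : ℕ := σ.path.length

theorem length_comp {i l : V} (σ : FramedPath ζ i) (a : l ⟶ i) :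
    (σ.comp a).length = σ.length + 1 := by
  simp [length, comp, Nat.add_comm]

theorem exists_base_or_comp {i : V} (σ : FramedPath ζ i) :
    (∃ q, σ = base i q) ∨ ∃ (j : V) (a : i ⟶ j) (τ : FramedPath ζ j), σ = τ.comp a := by
  obtain ⟨t, p, q⟩ := σ
  rcases hn : p.length with _ | n
  · obtain rfl := p.eq_of_length_zero hn
    obtain rfl := p.eq_nil_of_length_zero hn
    exact Or.inl ⟨q, rfl⟩
  · obtain ⟨j, a, p', -, rfl⟩ := p.eq_toPath_comp_of_length_eq_succ hn
    exact Or.inr ⟨j, a, ⟨t, p', q⟩, rfl⟩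

/-- Induction on framed paths by adjoining arrows at the start. -/
theorem induction_comp {P : ∀ i : V, FramedPath ζ i → Prop} (hb : ∀ i q, P i (base i q))
    (hc : ∀ (i j : V) (a : i ⟶ j) (τ : FramedPath ζ j), P j τ → P i (τ.comp a))
    (i : V) (σ : FramedPath ζ i) : P i σ := by
  induction hn : σ.length generalizing i with
  | zero =>
    rcases σ.exists_base_or_comp with ⟨q, rfl⟩ | ⟨j, a, τ, rfl⟩
    · exact hb i q
    · simp [length_comp] at hn
  | succ n ih =>
    rcases σ.exists_base_or_comp with ⟨q, rfl⟩ | ⟨j, a, τ, rfl⟩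
    · exact hb i q
    · exact hc i j a τ (ih j τ (by simpa [length_comp] using hn))

/-- The first arrow of a path, with the rest of the path. -/
def firstArrow {i : V} : ∀ {j : V}, Quiver.Path i j → Option (Σ l : V, (i ⟶ l) × Quiver.Path l j)
  | _, Quiver.Path.nil => none
  | _, Quiver.Path.cons Quiver.Path.nil e => some ⟨_, e, Quiver.Path.nil⟩
  | _, Quiver.Path.cons (Quiver.Path.cons p e') e =>
    (firstArrow (Quiver.Path.cons p e')).map fun x => ⟨x.1, x.2.1, x.2.2.cons e⟩

theorem firstArrow_toPath_comp {i l : V} (a : i ⟶ l) {j : V} (p : Quiver.Path l j) :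
    firstArrow ((Quiver.Hom.toPath a).comp p) = some ⟨l, a, p⟩ := by
  induction p with
  | nil => rfl
  | cons p e ih =>
    cases p with
    | nil => rfl
    | cons p e' =>
      rw [Quiver.Path.comp_cons, Quiver.Path.comp_cons, firstArrow, ← Quiver.Path.comp_cons, ih]
      rfl

theorem comp_injective {i : V} : Function.Injective
    fun x : Σ l : V, (i ⟶ l) × FramedPath ζ l => x.2.2.comp x.2.1 := by
  rintro ⟨l, a, t, p, q⟩ ⟨l', a', t', p', q'⟩ h
  simp only [comp, mk.injEq] at h
  obtain ⟨rfl, h1, h2⟩ := h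
  have h1 := congrArg firstArrow (eq_of_heq h1)
  rw [firstArrow_toPath_comp, firstArrow_toPath_comp, Option.some.injEq] at h1
  cases h1
  cases h2
  rfl

theorem base_injective (i : V) : Function.Injective (base (ζ := ζ) i) := by
  intro q q' h
  simpa [base] using h

theorem base_ne_comp {i j : V} (q : Fin (ζ i)) (a : i ⟶ j) (τ : FramedPath ζ j) :
    base i q ≠ τ.comp a := by
  intro h
  have := congrArg length h
  rw [length_comp] at this
  simp [base, length] at this

theorem finite_length_le [Finite V] [∀ i j : V, Finite (i ⟶ j)] (n : ℕ) (i : V) :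
    {σ : FramedPath ζ i | σ.length ≤ n}.Finite := by
  induction n generalizing i with
  | zero =>
    refine (finite_range (base i)).subset fun σ hσ => ?_
    rcases σ.exists_base_or_comp with ⟨q, rfl⟩ | ⟨j, a, τ, rfl⟩
    · exact ⟨q, rfl⟩
    · simp [length_comp] at hσ
  | succ n ih =>
    refine ((finite_range (base i)).union (finite_iUnion fun j => finite_iUnion fun a : i ⟶ j =>
      (ih j).image fun τ => τ.comp a)).subset fun σ hσ => ?_
    rcases σ.exists_base_or_comp with ⟨q, rfl⟩ | ⟨j, a, τ, rfl⟩
    · exact Or.inl ⟨q, rfl⟩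
    · refine Or.inr (mem_iUnion₂.mpr ⟨j, a, τ, ?_, rfl⟩)
      simpa [length_comp] using hσ

/-- The condition on a set of paths that `σ` belongs to it whenever `σ a` does. -/
def Closed (𝔖 : ∀ i : V, Set (FramedPath ζ i)) : Prop :=
  ∀ ⦃i l : V⦄ (σ : FramedPath ζ i) (a : l ⟶ i), σ.comp a ∈ 𝔖 l → σ ∈ 𝔖 i

theorem Closed.exists_length_eq {𝔖 : ∀ i : V, Set (FramedPath ζ i)} (h : Closed 𝔖) {i : V}
    {σ : FramedPath ζ i} (hσ : σ ∈ 𝔖 i) {m : ℕ} (hm : m ≤ σ.length) :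
    ∃ (j : V) (τ : FramedPath ζ j), τ ∈ 𝔖 j ∧ τ.length = m := by
  induction i, σ using induction_comp with
  | hb i q => exact ⟨i, _, hσ, by simpa [base, length, eq_comm] using hm⟩
  | hc i j a τ ih =>
    rcases hm.eq_or_lt with rfl | hlt
    · exact ⟨i, _, hσ, rfl⟩
    · rw [length_comp] at hlt
      exact ih (h τ a hσ) (Nat.lt_succ_iff.mp hlt)

end FramedPath

namespace FramedRep

variable {V : Type w} [Quiver.{h} V] {K : Type v} [Field K] {α ζ : V → ℕ}

/-- The path `σ` of `Q^ζ` as a linear form on `K ^ α i`, written as a row vector. -/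
def row (p : FramedRep K α ζ) {i : V} (σ : FramedPath ζ i) : Fin (α i) → K :=
  (p.frame σ.target * p.pathMap σ.path) σ.row

theorem phi_apply (p : FramedRep K α ζ) {i : V} (m : Fin (α i) → K) (σ : FramedPath ζ i) :
    p.phi i m σ = p.row σ ⬝ᵥ m := by
  simp only [phi, LinearMap.pi_apply, LinearMap.comp_apply, LinearMap.proj_apply,
    Matrix.mulVecLin_apply, Matrix.mulVec_mulVec]
  rfl

theorem pathMap_comp (p : FramedRep K α ζ) {i j l : V} (τ : Quiver.Path i j)
    (τ' : Quiver.Path j l) : p.pathMap (τ.comp τ') = p.pathMap τ' * p.pathMap τ := by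
  induction τ' with
  | nil => simp [pathMap]
  | cons τ' a ih => rw [Quiver.Path.comp_cons, pathMap, pathMap, ih, Matrix.mul_assoc]

theorem row_base (p : FramedRep K α ζ) (i : V) (q : Fin (ζ i)) :
    p.row (FramedPath.base i q) = p.frame i q := by
  change (p.frame i * (1 : Matrix (Fin (α i)) (Fin (α i)) K)) q = _
  rw [Matrix.mul_one]

theorem row_comp (p : FramedRep K α ζ) {i l : V} (σ : FramedPath ζ i) (a : l ⟶ i) :
    p.row (σ.comp a) = Matrix.vecMul (p.row σ) (p.map a) := by
  have h : p.pathMap (Quiver.Hom.toPath a) = p.map a := by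
    simp [Quiver.Hom.toPath, pathMap]
  change (p.frame σ.target * p.pathMap ((Quiver.Hom.toPath a).comp σ.path)) σ.row = _
  rw [pathMap_comp, h, ← Matrix.mul_assoc, Matrix.mul_apply_eq_vecMul]
  rfl

theorem row_smul (g : GLα K α) (p : FramedRep K α ζ) {i : V} (σ : FramedPath ζ i) :
    (g • p).row σ = Matrix.vecMul (p.row σ) (g i)⁻¹.1 := by
  induction i, σ using FramedPath.induction_comp with
  | hb i q =>
    rw [row_base, row_base]
    change (p.frame i * (g i)⁻¹.1) q = _
    rw [Matrix.mul_apply_eq_vecMul]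
  | hc i j a τ ih =>
    rw [row_comp, row_comp, ih]
    change Matrix.vecMul _ ((g j).1 * p.map a * (g i)⁻¹.1) = _
    rw [Matrix.vecMul_vecMul, Matrix.vecMul_vecMul, ← Matrix.mul_assoc, ← Matrix.mul_assoc,
      Units.inv_mul, Matrix.one_mul]

/-- The kernel of `φ` is the largest subrepresentation contained in the kernels of the `f_i`. -/
theorem stable_iff_injective_phi (p : FramedRep K α ζ) :
    p.Stable ↔ ∀ i, Function.Injective (p.phi i) := by
  constructor
  · intro h i
    refine LinearMap.ker_eq_bot.mp (h (fun i => LinearMap.ker (p.phi i)) ?_ ?_ i)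
    · intro i j a m hm
      rw [LinearMap.mem_ker] at hm ⊢
      ext σ
      have := congrFun hm (σ.comp a)
      rw [phi_apply, row_comp, ← Matrix.dotProduct_mulVec] at this
      rw [phi_apply, this]
      rfl
    · intro i m hm
      rw [LinearMap.mem_ker] at hm
      ext q
      have := congrFun hm (FramedPath.base i q)
      rw [phi_apply, row_base] at this
      exact this
  · intro h N hN hf i
    have key : ∀ (i : V) (σ : FramedPath ζ i), ∀ m ∈ N i, p.row σ ⬝ᵥ m = 0 := by
      intro i σ
      induction i, σ using FramedPath.induction_comp with
      | hb i q =>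
        intro m hm
        rw [row_base]
        exact congrFun (hf i m hm) q
      | hc i j a τ ih =>
        intro m hm
        rw [row_comp, ← Matrix.dotProduct_mulVec]
        exact ih _ (hN a m hm)
    refine (Submodule.eq_bot_iff _).mpr fun m hm => h i ?_
    rw [map_zero]
    ext σ
    rw [phi_apply, key i σ m hm]
    rfl

/-- If `φ_i` is injective then the dual of its image is identified with the space of row
vectors. -/
theorem exists_dual_equiv (p : FramedRep K α ζ) {i : V} (h : Function.Injective (p.phi i)) :
    ∃ E : Module.Dual K (LinearMap.range (p.phi i)) ≃ₗ[K] (Fin (α i) → K),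
      ∀ σ, E (p.pathRestr σ) = p.row σ := by
  refine ⟨(LinearEquiv.ofInjective (p.phi i) h).dualMap.trans (dotProductEquiv K _).symm, ?_⟩
  intro σ
  rw [LinearEquiv.trans_apply, LinearEquiv.symm_apply_eq]
  ext r
  simp [pathRestr, phi_apply]

theorem eq_of_dotProduct_row_eq {p : FramedRep K α ζ} {i : V} {s : Set (FramedPath ζ i)}
    (h : Submodule.span K (p.row '' s) = ⊤) {t : Set (FramedPath ζ i)} (hst : s ⊆ t)
    {m m' : Fin (α i) → K} (hm : ∀ σ ∈ t, p.row σ ⬝ᵥ m = p.row σ ⬝ᵥ m') : m = m' := by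
  refine dotProduct_eq _ _ fun c => ?_
  rw [dotProduct_comm m, dotProduct_comm m']
  have hc : c ∈ Submodule.span K (p.row '' s) := h ▸ Submodule.mem_top
  induction hc using Submodule.span_induction with
  | mem c hc =>
    obtain ⟨σ, hσ, rfl⟩ := hc
    exact hm σ (hst hσ)
  | zero => simp
  | add c c' _ _ h1 h2 => rw [add_dotProduct, add_dotProduct, h1, h2]
  | smul a c _ h1 => rw [smul_dotProduct, smul_dotProduct, h1]

theorem hasSkeleton_iff (p : FramedRep K α ζ) (𝔖 : ∀ i : V, Set (FramedPath ζ i)) :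
    p.HasSkeleton 𝔖 ↔ (∀ i, LinearIndepOn K p.row (𝔖 i)) ∧
      (∀ i, Submodule.span K (p.row '' 𝔖 i) = ⊤) ∧ FramedPath.Closed 𝔖 := by
  have key : (∀ i, Function.Injective (p.phi i)) →
      ((∀ i, LinearIndepOn K p.row (𝔖 i)) ↔
        ∀ i, LinearIndependent K fun σ : 𝔖 i => p.pathRestr σ.1) ∧
      ((∀ i, Submodule.span K (p.row '' 𝔖 i) = ⊤) ↔
        ∀ i, Submodule.span K (range fun σ : 𝔖 i => p.pathRestr σ.1) = ⊤) := by
    intro hinj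
    refine ⟨forall_congr' fun i => ?_, forall_congr' fun i => ?_⟩ <;>
    obtain ⟨E, hE⟩ := p.exists_dual_equiv (hinj i)
    · rw [← E.toLinearMap.linearIndependent_iff_of_injOn E.injective.injOn]
      rw [LinearIndepOn]
      have : (fun σ : 𝔖 i => p.row σ.1) = E.toLinearMap ∘ fun σ : 𝔖 i => p.pathRestr σ.1 := by
        ext1 σ
        simp [hE]
      rw [this]
    · have : p.row '' 𝔖 i = E.toLinearMap '' (range fun σ : 𝔖 i => p.pathRestr σ.1) := by
        rw [← range_comp, image_eq_range]
        congr 1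
        ext1 σ
        simp [hE]
      rw [this, ← Submodule.map_span]
      constructor
      · intro h
        apply Submodule.map_injective_of_injective E.injective
        rw [h, Submodule.map_top, LinearEquiv.range]
      · intro h
        rw [h, Submodule.map_top, LinearEquiv.range]
  constructor
  · rintro ⟨h1, h2, h3, h4⟩
    have := key ((stable_iff_injective_phi p).mp h1)
    exact ⟨this.1.mpr h2, this.2.mpr h3, h4⟩
  · rintro ⟨h2, h3, h4⟩
    have hinj : ∀ i, Function.Injective (p.phi i) := by
      intro i m m' hm
      refine eq_of_dotProduct_row_eq (h3 i) (subset_univ _) fun σ _ => ?_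
      rw [← phi_apply, ← phi_apply, hm]
    have := key hinj
    exact ⟨(stable_iff_injective_phi p).mpr hinj, this.1.mp h2, this.2.mp h3, h4⟩

theorem Stable.exists_notMem_span {p : FramedRep K α ζ} (hp : p.Stable) {i : V}
    {N : Submodule K (Fin (α i) → K)} (hN : N ≠ ⊤) : ∃ σ : FramedPath ζ i, p.row σ ∉ N := by
  by_contra! hcon
  obtain ⟨f, hf, hfN⟩ := Submodule.exists_le_ker_of_lt_top N hN.lt_top
  obtain ⟨m, rfl⟩ := (dotProductEquiv K _).surjective f
  refine hf ?_
  have : m = 0 := by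
    refine (stable_iff_injective_phi p).mp hp i ?_
    rw [map_zero]
    ext σ
    have := hfN (hcon σ)
    rw [LinearMap.mem_ker, dotProductEquiv_apply_apply, dotProduct_comm] at this
    rw [phi_apply, this]
    rfl
  rw [this, map_zero]

/-- If the rows of a closed set do not span, then a path can be added: take a path of least length
whose row is not in the span. If it is `τ a`, then the row of `τ` is a combination of rows of
paths `τ'` in the set, and the row of one of the paths `τ' a` is not in the span. -/
theorem Stable.exists_addable {p : FramedRep K α ζ} (hp : p.Stable)
    {𝔖 : ∀ i : V, Set (FramedPath ζ i)} {i₀ : V}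
    (h : Submodule.span K (p.row '' 𝔖 i₀) ≠ ⊤) :
    ∃ (i : V) (σ : FramedPath ζ i), p.row σ ∉ Submodule.span K (p.row '' 𝔖 i) ∧
      ∀ (j : V) (a : i ⟶ j) (τ : FramedPath ζ j), σ = τ.comp a → τ ∈ 𝔖 j := by
  obtain ⟨σ, hσ⟩ := hp.exists_notMem_span h
  induction i₀, σ using FramedPath.induction_comp with
  | hb i q => exact ⟨i, _, hσ, fun j a τ hτ => (FramedPath.base_ne_comp q a τ hτ).elim⟩
  | hc i j a τ ih =>
    by_cases hτ : p.row τ ∈ Submodule.span K (p.row '' 𝔖 j)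
    · by_contra! hcon
      have hle : Submodule.span K (p.row '' 𝔖 j) ≤
          (Submodule.span K (p.row '' 𝔖 i)).comap (p.map a).vecMulLinear := by
        rw [Submodule.span_le]
        rintro _ ⟨τ', hτ', rfl⟩
        by_contra hn
        rw [SetLike.mem_coe, Submodule.mem_comap, Matrix.vecMulLinear_apply, ← row_comp] at hn
        obtain ⟨j', a', τ'', h1, h2⟩ := hcon i _ hn
        have := FramedPath.comp_injective (a₁ := ⟨j, a, τ'⟩) (a₂ := ⟨j', a', τ''⟩) h1
        cases this
        exact h2 hτ'
      have := hle hτ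
      rw [Submodule.mem_comap, Matrix.vecMulLinear_apply, ← row_comp] at this
      exact hσ this
    · refine ih ?_ hτ
      intro htop
      exact hτ (htop ▸ Submodule.mem_top)

theorem ncard_le_of_linearIndepOn {p : FramedRep K α ζ} {i : V} {s : Set (FramedPath ζ i)}
    (h : LinearIndepOn K p.row s) : s.Finite ∧ s.ncard ≤ α i := by
  have hf : Finite s := LinearIndependent.finite h
  refine ⟨hf, ?_⟩
  have : Fintype s := Fintype.ofFinite s
  have h1 := LinearIndependent.fintype_card_le_finrank h
  rwa [Module.finrank_fin_fun, ← Nat.card_eq_fintype_card, Nat.card_coe_set_eq] at h1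

theorem Stable.exists_hasSkeleton [Finite V] {p : FramedRep K α ζ} (hp : p.Stable)
    {𝔗 : ∀ i : V, Set (FramedPath ζ i)} (hc : FramedPath.Closed 𝔗)
    (hl : ∀ i, LinearIndepOn K p.row (𝔗 i)) : ∃ 𝔖, p.HasSkeleton 𝔖 ∧ ∀ i, 𝔗 i ⊆ 𝔖 i := by
  classical
  have : Fintype V := Fintype.ofFinite V
  obtain ⟨𝔖, ⟨h1, h2, h3⟩, hmax⟩ := WellFounded.has_min
    (measure fun 𝔖 : ∀ i : V, Set (FramedPath ζ i) => ∑ i, α i - ∑ i, (𝔖 i).ncard).wf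
    {𝔖 | FramedPath.Closed 𝔖 ∧ (∀ i, LinearIndepOn K p.row (𝔖 i)) ∧ ∀ i, 𝔗 i ⊆ 𝔖 i}
    ⟨𝔗, hc, hl, fun _ => Subset.rfl⟩
  refine ⟨𝔖, (hasSkeleton_iff p 𝔖).mpr ⟨h2, ?_, h1⟩, h3⟩
  intro i₀
  by_contra hne
  obtain ⟨i, σ, hσ, hcl⟩ := hp.exists_addable hne
  have hnot : σ ∉ 𝔖 i := fun hmem => hσ (Submodule.subset_span ⟨σ, hmem, rfl⟩)
  set 𝔖' := Function.update 𝔖 i (insert σ (𝔖 i)) with h𝔖'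
  have hsub : ∀ j, 𝔖 j ⊆ 𝔖' j := by
    intro j
    by_cases hj : j = i
    · subst hj
      rw [h𝔖', Function.update_self]
      exact subset_insert _ _
    · rw [h𝔖', Function.update_of_ne hj]
  have hl' : ∀ j, LinearIndepOn K p.row (𝔖' j) := by
    intro j
    by_cases hj : j = i
    · subst hj
      rw [h𝔖', Function.update_self]
      exact (h2 j).insert hσ
    · rw [h𝔖', Function.update_of_ne hj]
      exact h2 j
  refine hmax 𝔖' ⟨?_, hl', fun j => (h3 j).trans (hsub j)⟩ ?_
  · intro j l τ a hτ
    by_cases hl : l = i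
    · subst hl
      rw [h𝔖', Function.update_self] at hτ
      rcases hτ with hτ | hτ
      · exact hsub j (hcl j a τ hτ.symm)
      · exact hsub j (h1 τ a hτ)
    · rw [h𝔖', Function.update_of_ne hl] at hτ
      exact hsub j (h1 τ a hτ)
  · have hlt : ∑ j, (𝔖 j).ncard < ∑ j, (𝔖' j).ncard := by
      refine Finset.sum_lt_sum
        (fun j _ => ncard_le_ncard (hsub j) (ncard_le_of_linearIndepOn (hl' j)).1)
        ⟨i, Finset.mem_univ _, ?_⟩
      rw [h𝔖', Function.update_self,
        ncard_insert_of_notMem hnot (ncard_le_of_linearIndepOn (h2 i)).1]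
      exact Nat.lt_succ_self _
    have hle : ∑ j, (𝔖' j).ncard ≤ ∑ j, α j :=
      Finset.sum_le_sum fun j _ => (ncard_le_of_linearIndepOn (hl' j)).2
    change ∑ i, α i - ∑ i, (𝔖' i).ncard < ∑ i, α i - ∑ i, (𝔖 i).ncard
    omega

end FramedRep

end

/-! ### Skeleta -/

noncomputable section

variable {V : Type w} [Quiver.{h} V] {K : Type v} [Field K] {α ζ : V → ℕ}

variable (α ζ) in
/-- A closed set of framed paths with `α i` elements starting at `i`, which are enumerated. These
conditions do not refer to a representation or a field; the `J`-skeleta are the sets of this kind.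
The enumeration turns the families of rows indexed by the skeleton into square matrices. -/
structure EnumSkeleton where
  set : ∀ i : V, Set (FramedPath ζ i)
  enum : ∀ i : V, Fin (α i) ≃ set i
  closed : FramedPath.Closed set

theorem exists_enumSkeleton {𝔖 : ∀ i : V, Set (FramedPath ζ i)} (h : 𝔖 ∈ skeleta K α ζ) :
    ∃ S : EnumSkeleton α ζ, S.set = 𝔖 := by
  obtain ⟨p, hp⟩ := h
  obtain ⟨h1, h2, h3⟩ := (p.hasSkeleton_iff 𝔖).mp hp
  have hcard : ∀ i, Nonempty (Fin (α i) ≃ 𝔖 i) := by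
    intro i
    have b : Module.Basis (𝔖 i) K (Fin (α i) → K) := Module.Basis.mk (h1 i) (by
      rw [← image_eq_range, h2 i])
    exact ⟨(Pi.basisFun K (Fin (α i))).indexEquiv b⟩
  exact ⟨⟨𝔖, fun i => (hcard i).some, h3⟩, rfl⟩

variable (α ζ) in
/-- The dimension of the moduli space, the number of matrix entries of a framed representation
minus the dimension of `GL(α)`. It is natural number subtraction, which does not truncate if there
is a skeleton. -/
def moduliDim : ℕ :=
  Nat.card (Σ i : V, (Fin (ζ i) ⊕ (Σ j : V, (i ⟶ j) × Fin (α j))) × Fin (α i)) -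
    Nat.card (Σ i : V, Fin (α i) × Fin (α i))

namespace EnumSkeleton

variable (S : EnumSkeleton α ζ)

/-- The rows of the paths in the skeleton, as a square matrix. -/
def basisMatrix (p : FramedRep K α ζ) (i : V) : Matrix (Fin (α i)) (Fin (α i)) K :=
  Matrix.of fun r => p.row (S.enum i r).1

theorem hasSkeleton_iff_det (p : FramedRep K α ζ) :
    p.HasSkeleton S.set ↔ ∀ i, (S.basisMatrix p i).det ≠ 0 := by
  have key : ∀ i, LinearIndepOn K p.row (S.set i) ↔ (S.basisMatrix p i).det ≠ 0 := by
    intro i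
    rw [← isUnit_iff_ne_zero, ← Matrix.isUnit_iff_isUnit_det,
      ← Matrix.linearIndependent_rows_iff_isUnit]
    exact (linearIndependent_equiv (S.enum i)).symm
  rw [p.hasSkeleton_iff]
  constructor
  · rintro ⟨h, -, -⟩ i
    exact (key i).mp (h i)
  · intro h
    have hl := fun i => (key i).mpr (h i)
    refine ⟨hl, fun i => ?_, S.closed⟩
    have : Fintype (S.set i) := Fintype.ofEquiv _ (S.enum i)
    rw [image_eq_range]
    refine LinearIndependent.span_eq_top_of_card_eq_finrank' (hl i) ?_
    rw [Module.finrank_fin_fun, ← Fintype.card_congr (S.enum i), Fintype.card_fin]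

theorem basisMatrix_smul (g : GLα K α) (p : FramedRep K α ζ) (i : V) :
    S.basisMatrix (g • p) i = S.basisMatrix p i * (g i)⁻¹.1 := by
  refine funext fun r => ?_
  rw [Matrix.mul_apply_eq_vecMul]
  exact p.row_smul g _

theorem basisMatrix_eq_one {p : FramedRep K α ζ}
    (h : ∀ i r, p.row (S.enum i r).1 = Pi.single r 1) (i : V) : S.basisMatrix p i = 1 := by
  ext r c
  change p.row (S.enum i r).1 c = _
  rw [h, Matrix.one_apply, Pi.single_apply]
  simp only [eq_comm]

theorem row_enum {p : FramedRep K α ζ} {i : V} (h : S.basisMatrix p i = 1) (r : Fin (α i)) :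
    p.row (S.enum i r).1 = Pi.single r 1 := by
  change S.basisMatrix p i r = _
  rw [h]
  ext c
  rw [Matrix.one_apply, Pi.single_apply]
  simp only [eq_comm]

/-! ### Normal forms -/

/-- The paths `f_{i q}`, and the paths `τ a` with `τ` in the skeleton. -/
def extend (i : V) : Fin (ζ i) ⊕ (Σ j : V, (i ⟶ j) × Fin (α j)) → FramedPath ζ i :=
  Sum.elim (FramedPath.base i) fun x => (S.enum x.1 x.2.2).1.comp x.2.1

theorem extend_injective (i : V) : Function.Injective (S.extend i) := by
  rintro (q | ⟨j, a, r⟩) (q' | ⟨j', a', r'⟩) h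
  · exact congrArg _ (FramedPath.base_injective i h)
  · exact (FramedPath.base_ne_comp q a' _ h).elim
  · exact (FramedPath.base_ne_comp q' a _ h.symm).elim
  · have := FramedPath.comp_injective (a₁ := ⟨j, a, (S.enum j r).1⟩)
      (a₂ := ⟨j', a', (S.enum j' r').1⟩) h
    rw [Sigma.mk.injEq] at this
    obtain ⟨rfl, h2⟩ := this
    rw [heq_eq_eq, Prod.mk.injEq] at h2
    obtain ⟨rfl, h3⟩ := h2
    rw [(S.enum j).injective (Subtype.ext h3)]

theorem subset_range_extend (i : V) : S.set i ⊆ range (S.extend i) := by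
  intro σ hσ
  rcases σ.exists_base_or_comp with ⟨q, rfl⟩ | ⟨j, a, τ, rfl⟩
  · exact ⟨Sum.inl q, rfl⟩
  · refine ⟨Sum.inr ⟨j, a, (S.enum j).symm ⟨τ, S.closed τ a hσ⟩⟩, ?_⟩
    simp [extend]

/-- The paths `f_{i q}` and `τ a`, with `τ` in the skeleton, that are not in the skeleton. -/
def border (i : V) : Set (FramedPath ζ i) := range (S.extend i) \ S.set i

/-- The index set of the coordinates of the quotient of the chart. -/
abbrev Index : Type (max w h) := Σ i : V, S.border i × Fin (α i)

instance [Finite V] [∀ i j : V, Finite (i ⟶ j)] : Finite S.Index := by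
  have : ∀ i, Finite (S.border i) := fun i => ((finite_range (S.extend i)).sdiff).to_subtype
  infer_instance

/-- The representation whose matrices have as rows the given row vectors, attached to the paths
`τ a` and `f_{i q}`. -/
def ofRows {F : Type v} (β : ∀ i : V, FramedPath ζ i → Fin (α i) → F) : FramedRep F α ζ where
  map i j a := Matrix.of fun r => β i ((S.enum j r).1.comp a)
  frame i := Matrix.of fun q => β i (FramedPath.base i q)

theorem ofRows_congr {F : Type v} {β β' : ∀ i : V, FramedPath ζ i → Fin (α i) → F}
    (h : ∀ i, ∀ σ ∈ range (S.extend i), β i σ = β' i σ) : S.ofRows β = S.ofRows β' := by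
  apply FramedRep.ext
  · funext i j a
    refine funext fun r => ?_
    exact h i _ ⟨Sum.inr ⟨j, a, r⟩, rfl⟩
  · funext i
    refine funext fun q => ?_
    exact h i _ ⟨Sum.inl q, rfl⟩

/-- By induction along the closed set `S`, the rows of `ofRows β` are the prescribed ones. -/
theorem row_ofRows {β : ∀ i : V, FramedPath ζ i → Fin (α i) → K}
    (hβ : ∀ i r, β i (S.enum i r).1 = Pi.single r 1) {i : V} {σ : FramedPath ζ i}
    (hσ : σ ∈ range (S.extend i)) : (S.ofRows β).row σ = β i σ := by
  induction i, σ using FramedPath.induction_comp with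
  | hb i q => rw [FramedRep.row_base]; rfl
  | hc i j a τ ih =>
    obtain ⟨q | ⟨j', a', r⟩, hx⟩ := hσ
    · exact (FramedPath.base_ne_comp q a τ hx).elim
    · have := FramedPath.comp_injective (a₁ := ⟨j', a', (S.enum j' r).1⟩) (a₂ := ⟨j, a, τ⟩) hx
      cases this
      rw [FramedRep.row_comp, ih (S.subset_range_extend _ (S.enum _ r).2), hβ,
        Matrix.single_one_vecMul]
      rfl

theorem basisMatrix_ofRows {β : ∀ i : V, FramedPath ζ i → Fin (α i) → K}
    (hβ : ∀ i r, β i (S.enum i r).1 = Pi.single r 1) (i : V) :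
    S.basisMatrix (S.ofRows β) i = 1 :=
  S.basisMatrix_eq_one (fun i r => by
    rw [S.row_ofRows hβ (S.subset_range_extend i (S.enum i r).2), hβ]) i

theorem eq_ofRows {p : FramedRep K α ζ} (h : ∀ i, S.basisMatrix p i = 1) :
    p = S.ofRows fun _ σ => p.row σ := by
  apply FramedRep.ext
  · funext i j a
    refine funext fun r => ?_
    change _ = p.row ((S.enum j r).1.comp a)
    rw [FramedRep.row_comp, S.row_enum (h j), Matrix.single_one_vecMul]
    rfl
  · funext i
    refine funext fun q => ?_
    change _ = p.row (FramedPath.base i q)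
    rw [FramedRep.row_base]

open Classical in
/-- The rows of the normal form with given coordinates. -/
def normalRows (c : S.Index → K) (i : V) (σ : FramedPath ζ i) : Fin (α i) → K :=
  if hσ : σ ∈ S.set i then Pi.single ((S.enum i).symm ⟨σ, hσ⟩) 1
  else if hσ : σ ∈ S.border i then fun r => c ⟨i, ⟨σ, hσ⟩, r⟩ else 0

theorem normalRows_enum (c : S.Index → K) (i : V) (r : Fin (α i)) :
    S.normalRows c i (S.enum i r).1 = Pi.single r 1 := by
  rw [normalRows, dif_pos (S.enum i r).2]
  simp

theorem normalRows_border (c : S.Index → K) (b : S.Index) :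
    S.normalRows c b.1 b.2.1.1 b.2.2 = c b := by
  rw [normalRows, dif_neg b.2.1.2.2, dif_pos b.2.1.2]

/-- The representation in normal form, with unit vectors as rows of the paths in the skeleton,
that has given coordinates. -/
def normalForm (c : S.Index → K) : FramedRep K α ζ := S.ofRows (S.normalRows c)

theorem ofRows_eq_normalForm {β : ∀ i : V, FramedPath ζ i → Fin (α i) → K}
    (hβ : ∀ i r, β i (S.enum i r).1 = Pi.single r 1) :
    S.ofRows β = S.normalForm fun b => β b.1 b.2.1.1 b.2.2 := by
  refine S.ofRows_congr fun i σ hσ => ?_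
  by_cases h : σ ∈ S.set i
  · obtain ⟨r, hr⟩ := (S.enum i).surjective ⟨σ, h⟩
    obtain rfl : (S.enum i r).1 = σ := congrArg Subtype.val hr
    rw [hβ, normalRows_enum]
  · have hb : σ ∈ S.border i := ⟨hσ, h⟩
    rw [normalRows, dif_neg h, dif_pos hb]

theorem basisMatrix_normalForm (c : S.Index → K) (i : V) :
    S.basisMatrix (S.normalForm c) i = 1 :=
  S.basisMatrix_ofRows (S.normalRows_enum c) i

theorem hasSkeleton_normalForm (c : S.Index → K) : (S.normalForm c).HasSkeleton S.set := by
  rw [hasSkeleton_iff_det]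
  intro i
  rw [basisMatrix_normalForm, Matrix.det_one]
  exact one_ne_zero

theorem mem_skeleta : S.set ∈ skeleta K α ζ := ⟨_, S.hasSkeleton_normalForm 0⟩

/-- The coordinates of the normal form of `p`. -/
def coords (p : FramedRep K α ζ) (b : S.Index) : K :=
  Matrix.vecMul (p.row b.2.1.1) (S.basisMatrix p b.1)⁻¹ b.2.2

/-- The basis matrices, as an element of `GL(α)`. -/
def basisGL {p : FramedRep K α ζ} (hp : p.HasSkeleton S.set) : GLα K α := fun i =>
  Matrix.GeneralLinearGroup.mkOfDetNeZero _ ((S.hasSkeleton_iff_det p).mp hp i)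

theorem basisGL_val {p : FramedRep K α ζ} (hp : p.HasSkeleton S.set) (i : V) :
    (S.basisGL hp i).1 = S.basisMatrix p i := rfl

theorem basisGL_inv {p : FramedRep K α ζ} (hp : p.HasSkeleton S.set) (i : V) :
    (S.basisGL hp i)⁻¹.1 = (S.basisMatrix p i)⁻¹ := by
  rw [Matrix.coe_units_inv, basisGL_val]

theorem basisGL_smul {p : FramedRep K α ζ} (hp : p.HasSkeleton S.set) :
    S.basisGL hp • p = S.normalForm (S.coords p) := by
  have h1 : ∀ i, S.basisMatrix (S.basisGL hp • p) i = 1 := by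
    intro i
    rw [basisMatrix_smul, ← S.basisGL_val hp, Units.mul_inv]
  rw [S.eq_ofRows h1, S.ofRows_eq_normalForm fun i r => S.row_enum (h1 i) r]
  congr 1
  funext b
  rw [FramedRep.row_smul, basisGL_inv]
  rfl

theorem hasSkeleton_smul (g : GLα K α) {p : FramedRep K α ζ} (hp : p.HasSkeleton S.set) :
    (g • p).HasSkeleton S.set := by
  rw [hasSkeleton_iff_det] at hp ⊢
  intro i
  rw [basisMatrix_smul, Matrix.det_mul]
  exact mul_ne_zero (hp i) (((Matrix.isUnit_iff_isUnit_det _).mp (g i)⁻¹.isUnit).ne_zero)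

theorem coords_smul (g : GLα K α) (p : FramedRep K α ζ) :
    S.coords (g • p) = S.coords p := by
  funext b
  rw [coords, coords, basisMatrix_smul, FramedRep.row_smul, Matrix.mul_inv_rev,
    Matrix.vecMul_vecMul, ← Matrix.mul_assoc,
    Matrix.mul_nonsing_inv _ (Matrix.isUnits_det_units _), Matrix.one_mul]

theorem coords_normalForm (c : S.Index → K) : S.coords (S.normalForm c) = c := by
  funext b
  rw [coords, basisMatrix_normalForm, inv_one, Matrix.vecMul_one, normalForm,
    S.row_ofRows (S.normalRows_enum c) b.2.1.2.1, normalRows_border]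

theorem card_index [Finite V] [∀ i j : V, Finite (i ⟶ j)] :
    Nat.card S.Index = moduliDim α ζ := by
  classical
  have e : (Σ i : V, Fin (α i) × Fin (α i)) ⊕ S.Index ≃
      Σ i : V, (Fin (ζ i) ⊕ (Σ j : V, (i ⟶ j) × Fin (α j))) × Fin (α i) :=
    (Equiv.sigmaSumDistrib _ _).symm.trans <| Equiv.sigmaCongrRight fun i =>
      (Equiv.sumProdDistrib _ _ _).symm.trans <| Equiv.prodCongrLeft fun _ =>
        ((Equiv.sumCongr (S.enum i) (Equiv.refl _)).trans
          (Equiv.Set.sumDiffSubset (S.subset_range_extend i))).trans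
            (Equiv.ofInjective _ (S.extend_injective i)).symm
  rw [moduliDim, ← Nat.card_congr e, Nat.card_sum, Nat.add_sub_cancel_left]

end EnumSkeleton

theorem finite_skeleta [Finite V] [∀ i j : V, Finite (i ⟶ j)] : (skeleta K α ζ).Finite := by
  have : Fintype V := Fintype.ofFinite V
  refine (Finite.pi fun i => (FramedPath.finite_length_le (ζ := ζ) (∑ i, α i) i).powerset).subset ?_
  intro 𝔖 h𝔖
  obtain ⟨S, rfl⟩ := exists_enumSkeleton h𝔖
  intro i _ σ hσ
  -- The final pieces of `σ` have different lengths, and they all belong to the skeleton.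
  have hsub : (Finset.range (σ.length + 1)) ⊆ Finset.univ.image
      fun x : Σ i : V, Fin (α i) => (S.enum x.1 x.2).1.length := by
    intro m hm
    obtain ⟨j, τ, hτ, rfl⟩ :=
      S.closed.exists_length_eq hσ (Nat.lt_succ_iff.mp (Finset.mem_range.mp hm))
    exact Finset.mem_image.mpr ⟨⟨j, (S.enum j).symm ⟨τ, hτ⟩⟩, Finset.mem_univ _, by simp⟩
  have := (Finset.card_le_card hsub).trans Finset.card_image_le
  rw [Finset.card_range, Finset.card_univ, Fintype.card_sigma] at this
  simp only [Fintype.card_fin] at this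
  exact (Nat.le_succ _).trans this

theorem exists_enumSkeleton_of_stable [Finite V] {p : FramedRep K α ζ} (hp : p.Stable) :
    ∃ S : EnumSkeleton α ζ, p.HasSkeleton S.set := by
  obtain ⟨𝔖, h, -⟩ := hp.exists_hasSkeleton (𝔗 := fun _ => ∅) (fun _ _ _ _ h => h)
    (fun _ => linearIndepOn_empty _ _)
  obtain ⟨S, rfl⟩ := exists_enumSkeleton (K := K) ⟨p, h⟩
  exact ⟨S, h⟩

end

/-! ### The charts of the moduli space -/

noncomputable section

open FunSpace

variable {k : Type u} {K : Type v} [Field k] [Field K] [Algebra k K]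
  {V : Type w} [Quiver.{h} V] {α ζ : V → ℕ} {X : Type x}

theorem isLocal_stableSpace : (stableSpace K α ζ k).IsLocal := (isLocal_affine _).induced _

/-- A map to framed representations whose matrix entries are regular functions. -/
structure FramedReg (T : FunSpace k K X) (φ : X → FramedRep K α ζ) : Prop where
  map : ∀ ⦃i j : V⦄ (a : i ⟶ j), T.MatReg fun b => (φ b).map a
  frame : ∀ i, T.MatReg fun b => (φ b).frame i

theorem FramedReg.isMorphism {T : FunSpace k K X} (hT : T.IsLocal) {φ : X → StableRep K α ζ}
    (hφ : FramedReg T fun b => (φ b).1) : IsMorphism T (stableSpace K α ζ k) φ := by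
  refine IsMorphism.codInduced (hT.isMorphism_affine ?_)
  rintro (⟨i, j, a, r, c⟩ | ⟨i, r, c⟩)
  · exact hφ.map a r c
  · exact hφ.frame i r c

theorem framedReg_val : FramedReg (stableSpace K α ζ k) fun p => p.1 := by
  have h := isMorphism_induced (affine k K _) fun p : StableRep K α ζ => p.1.coord
  refine ⟨fun i j a r c => ?_, fun i r c => ?_⟩
  · have := h.comp_mem (coord_mem_reg (Sum.inl ⟨i, j, a, r, c⟩))
    exact this
  · have := h.comp_mem (coord_mem_reg (Sum.inr ⟨i, r, c⟩))
    exact this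

theorem IsMorphism.framedReg {T : FunSpace k K X} {φ : X → StableRep K α ζ}
    (hφ : IsMorphism T (stableSpace K α ζ k) φ) : FramedReg T fun b => (φ b).1 :=
  ⟨fun _ _ a => (framedReg_val.map a).comp hφ, fun i => (framedReg_val.frame i).comp hφ⟩

theorem FramedReg.pathMap {T : FunSpace k K X} {φ : X → FramedRep K α ζ} (hφ : FramedReg T φ)
    {i j : V} (τ : Quiver.Path i j) : T.MatReg fun b => (φ b).pathMap τ := by
  induction τ with
  | nil => exact matReg_one
  | cons τ a ih => exact (hφ.map a).mul ih

theorem FramedReg.row {T : FunSpace k K X} {φ : X → FramedRep K α ζ} (hφ : FramedReg T φ)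
    {i : V} (σ : FramedPath ζ i) (c : Fin (α i)) : (fun b => (φ b).row σ c) ∈ T.reg univ :=
  (hφ.frame σ.target).mul (hφ.pathMap σ.path) σ.row c

theorem FramedReg.smul {T : FunSpace k K X} (hT : T.IsLocal) {φ : X → FramedRep K α ζ}
    (hφ : FramedReg T φ) {g : X → GLα K α} (hg : ∀ i, T.MatReg fun b => (g b i).1) :
    FramedReg T fun b => g b • φ b := by
  have hinv : ∀ i, T.MatReg fun b => (g b i)⁻¹.1 := by
    intro i
    simp only [Matrix.coe_units_inv]
    exact (hg i).inv hT fun b => (Matrix.isUnits_det_units (g b i)).ne_zero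
  exact ⟨fun i j a => ((hg j).mul (hφ.map a)).mul (hinv i), fun i => (hφ.frame i).mul (hinv i)⟩

theorem quotMap_eq_iff {p q : StableRep K α ζ} :
    quotMap K α ζ p = quotMap K α ζ q ↔ ∃ g : GLα K α, g • q.1 = p.1 := by
  rw [quotMap, Quotient.eq]
  rfl

namespace EnumSkeleton

variable (S : EnumSkeleton α ζ)

theorem matReg_basisMatrix {T : FunSpace k K X} {φ : X → FramedRep K α ζ} (hφ : FramedReg T φ)
    (i : V) : T.MatReg fun b => S.basisMatrix (φ b) i := fun r c => hφ.row (S.enum i r).1 c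

theorem isOpen_chart [Finite V] :
    IsOpen[(stableSpace K α ζ k).toTopologicalSpace] (chart S.set) := by
  let _ := (stableSpace K α ζ k).toTopologicalSpace
  have : (chart S.set : Set (StableRep K α ζ)) = ⋂ i, {p | (S.basisMatrix p.1 i).det ≠ 0} := by
    ext p
    rw [mem_iInter]
    exact S.hasSkeleton_iff_det p.1
  rw [this]
  exact isOpen_iInter_of_finite fun i =>
    isLocal_stableSpace.isOpen_ne_zero (S.matReg_basisMatrix framedReg_val i).det

theorem preimage_image_chart :
    quotMap K α ζ ⁻¹' (quotMap K α ζ '' chart S.set) = chart S.set := by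
  refine Subset.antisymm ?_ (subset_preimage_image _ _)
  rintro p ⟨q, hq, hqp⟩
  obtain ⟨g, hg⟩ := quotMap_eq_iff.mp hqp.symm
  change p.1.HasSkeleton S.set
  rw [← hg]
  exact S.hasSkeleton_smul g hq

/-- The section of the quotient map over the quotient of the chart. -/
def stableNormalForm (c : S.Index → K) : StableRep K α ζ :=
  ⟨S.normalForm c, (S.hasSkeleton_normalForm c).stable⟩

theorem quotMap_stableNormalForm {p : StableRep K α ζ} (hp : p ∈ chart S.set) :
    quotMap K α ζ (S.stableNormalForm (S.coords p.1)) = quotMap K α ζ p :=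
  quotMap_eq_iff.mpr ⟨S.basisGL hp, S.basisGL_smul hp⟩

theorem coords_eq {p q : StableRep K α ζ} (h : quotMap K α ζ p = quotMap K α ζ q) :
    S.coords p.1 = S.coords q.1 := by
  obtain ⟨g, hg⟩ := quotMap_eq_iff.mp h
  rw [← hg, coords_smul]

theorem framedReg_normalForm {T : FunSpace k K X} {c : X → S.Index → K}
    (hc : ∀ b, (fun y => c y b) ∈ T.reg univ) : FramedReg T fun y => S.normalForm (c y) := by
  have h : ∀ i (σ : FramedPath ζ i) r, (fun y => S.normalRows (c y) i σ r) ∈ T.reg univ := by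
    intro i σ r
    simp only [normalRows]
    split_ifs with h1 h2
    · by_cases hr : r = (S.enum i).symm ⟨σ, h1⟩
      · subst hr
        simp only [Pi.single_eq_same]
        exact one_mem _
      · simp only [ne_eq, hr, not_false_eq_true, Pi.single_eq_of_ne]
        exact zero_mem _
    · exact hc _
    · exact zero_mem _
  exact ⟨fun i j a r s => h i _ s, fun i r s => h i _ s⟩

theorem isMorphism_stableNormalForm {T : FunSpace k K X} (hT : T.IsLocal) {c : X → S.Index → K}
    (hc : ∀ b, (fun y => c y b) ∈ T.reg univ) :
    IsMorphism T (stableSpace K α ζ k) fun y => S.stableNormalForm (c y) :=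
  FramedReg.isMorphism hT (S.framedReg_normalForm hc)

theorem coords_mem_reg {T : FunSpace k K X} (hT : T.IsLocal) {φ : X → FramedRep K α ζ}
    (hφ : FramedReg T φ) (h0 : ∀ b, (φ b).HasSkeleton S.set) (b : S.Index) :
    (fun y => S.coords (φ y) b) ∈ T.reg univ := by
  have h1 : T.MatReg fun y => Matrix.of fun (_ : Unit) => (φ y).row b.2.1.1 :=
    fun _ c => hφ.row _ c
  exact h1.mul ((S.matReg_basisMatrix hφ b.1).inv hT fun y =>
    (S.hasSkeleton_iff_det _).mp (h0 y) b.1) () b.2.2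

/-- The trivialization of the chart: a representation is determined by the element of `GL(α)` that
maps its normal form to it, and the coordinates of the normal form. -/
def chartEquiv {N : ℕ} (ε : S.Index ≃ Fin N) :
    (chart S.set : Set (StableRep K α ζ)) ≃ GLα K α × (Fin N → K) where
  toFun p := ((S.basisGL p.2)⁻¹, fun n => S.coords p.1.1 (ε.symm n))
  invFun x := ⟨⟨x.1 • S.normalForm fun b => x.2 (ε b),
    (S.hasSkeleton_smul _ (S.hasSkeleton_normalForm _)).stable⟩,
    S.hasSkeleton_smul _ (S.hasSkeleton_normalForm _)⟩
  left_inv p := by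
    refine Subtype.ext (Subtype.ext ?_)
    simp only [Equiv.symm_apply_apply]
    exact inv_smul_eq_iff.mpr (S.basisGL_smul p.2).symm
  right_inv x := by
    refine Prod.ext ?_ ?_
    · refine inv_eq_iff_eq_inv.mpr (funext fun i => Units.ext ?_)
      change S.basisMatrix (x.1 • S.normalForm fun b => x.2 (ε b)) i = (x.1 i)⁻¹.1
      rw [basisMatrix_smul, basisMatrix_normalForm, Matrix.one_mul]
    · funext n
      change S.coords (x.1 • S.normalForm fun b => x.2 (ε b)) (ε.symm n) = x.2 n
      rw [coords_smul, coords_normalForm, Equiv.apply_symm_apply]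

/-- The isomorphism of the quotient of the chart with affine space. -/
def quotChartEquiv {N : ℕ} (ε : S.Index ≃ Fin N) :
    (quotMap K α ζ '' chart S.set : Set (Moduli K α ζ)) ≃ (Fin N → K) :=
  (Equiv.ofBijective (fun c : Fin N → K =>
    (⟨quotMap K α ζ (S.stableNormalForm fun b => c (ε b)),
      mem_image_of_mem _ (S.hasSkeleton_normalForm _)⟩ : ↥(quotMap K α ζ '' chart S.set))) <| by
    constructor
    · intro c c' h
      have := S.coords_eq (congrArg Subtype.val h)
      simp only [stableNormalForm, coords_normalForm] at this
      funext n
      simpa using congrFun this (ε.symm n)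
    · rintro ⟨_, p, hp, rfl⟩
      refine ⟨fun n => S.coords p.1 (ε.symm n), Subtype.ext ?_⟩
      simp only [Equiv.symm_apply_apply]
      exact S.quotMap_stableNormalForm hp).symm

theorem quotChartEquiv_quotMap {N : ℕ} (ε : S.Index ≃ Fin N)
    (p : (chart S.set : Set (StableRep K α ζ))) :
    S.quotChartEquiv ε ⟨quotMap K α ζ p.1, mem_image_of_mem _ p.2⟩ = (S.chartEquiv ε p).2 := by
  rw [quotChartEquiv, Equiv.symm_apply_eq]
  refine Subtype.ext ?_
  change _ = quotMap K α ζ (S.stableNormalForm fun b => S.coords p.1.1 (ε.symm (ε b)))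
  simp only [Equiv.symm_apply_apply]
  exact (S.quotMap_stableNormalForm p.2).symm

theorem isIso_chartEquiv {N : ℕ} (ε : S.Index ≃ Fin N) :
    ((stableSpace K α ζ k).sub (chart S.set)).IsIso (glAffineSpace K α k N) (S.chartEquiv ε) := by
  have hT : ((stableSpace K α ζ k).sub (chart S.set)).IsLocal := isLocal_stableSpace.induced _
  have hG : (glAffineSpace K α k N).IsLocal := (isLocal_affine _).induced _
  have hval := IsMorphism.framedReg (isMorphism_induced (stableSpace K α ζ k)
    (Subtype.val : ↥(chart S.set : Set (StableRep K α ζ)) → _))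
  refine ⟨IsMorphism.codInduced (hT.isMorphism_affine ?_), IsMorphism.codInduced
    (FramedReg.isMorphism hG ?_)⟩
  · rintro (⟨i, r, c⟩ | n)
    · have := (S.matReg_basisMatrix hval i).inv hT fun p => (S.hasSkeleton_iff_det _).mp p.2 i
      exact FunSpace.reg_congr _
        (fun p _ => (congrFun (congrFun (S.basisGL_inv p.2 i) r) c).symm) (this r c)
    · exact S.coords_mem_reg hT hval (fun p => p.2) _
  · have h := isMorphism_induced (affine k K ((Σ i : V, Fin (α i) × Fin (α i)) ⊕ Fin N))
      fun x : GLα K α × (Fin N → K) => Sum.elim (fun c => (x.1 c.1).1 c.2.1 c.2.2) x.2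
    exact (S.framedReg_normalForm fun b => h.comp_mem (coord_mem_reg (Sum.inr (ε b)))).smul hG
      fun i r c => by
        have := h.comp_mem (coord_mem_reg (Sum.inl ⟨i, r, c⟩))
        exact this

theorem isIso_quotChartEquiv [Finite V] {N : ℕ} (ε : S.Index ≃ Fin N) :
    ((moduliSpace K α ζ k).sub (quotMap K α ζ '' chart S.set)).IsIso (affine k K (Fin N))
      (S.quotChartEquiv ε) := by
  have hT : ((stableSpace K α ζ k).sub (chart S.set)).IsLocal := isLocal_stableSpace.induced _
  have hval := IsMorphism.framedReg (isMorphism_induced (stableSpace K α ζ k)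
    (Subtype.val : ↥(chart S.set : Set (StableRep K α ζ)) → _))
  refine ⟨IsMorphism.of_quotient_sub S.isOpen_chart S.preimage_image_chart ?_,
    IsMorphism.codInduced ?_⟩
  · have : (fun p : (chart S.set : Set (StableRep K α ζ)) => S.quotChartEquiv ε
        ⟨quotMap K α ζ p.1, mem_image_of_mem _ p.2⟩) = fun p => (S.chartEquiv ε p).2 :=
      funext (S.quotChartEquiv_quotMap ε)
    rw [this]
    exact hT.isMorphism_affine fun n => S.coords_mem_reg hT hval (fun p => p.2) _
  · exact (isMorphism_quotient (stableSpace K α ζ k) (quotMap K α ζ)).comp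
      (S.isMorphism_stableNormalForm (isLocal_affine (Fin N)) fun b => coord_mem_reg (ε b))

end EnumSkeleton

end

/-! ### The embedding into the product of Grassmannians -/

noncomputable section

open FunSpace

variable {k : Type u} {K : Type v} [Field k] [Field K] [Algebra k K]
  {V : Type w} {α ζ : V → ℕ}

section Grassmannian

variable {W : V → Type x}

variable (K α W k) in
/-- The variety of families of injective matrices. -/
def ihomSpace : FunSpace k K (IHom K α W) :=
  (affine k K (Σ i : V, W i × Fin (α i))).induced fun B c => (B c.1).1 c.2.1 c.2.2

theorem isLocal_ihomSpace : (ihomSpace k K α W).IsLocal := (isLocal_affine _).induced _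

theorem matReg_ihomSpace (i : V) : (ihomSpace k K α W).MatReg fun B => (B i).1 := by
  intro r c
  have := (isMorphism_induced (affine k K (Σ i : V, W i × Fin (α i)))
    fun (B : IHom K α W) c => (B c.1).1 c.2.1 c.2.2).comp_mem (coord_mem_reg ⟨i, r, c⟩)
  exact this

theorem exists_eq_mul_of_range_le {m : Type x} {n : ℕ} {B B' : Matrix m (Fin n) K}
    (h : LinearMap.range B.mulVecLin ≤ LinearMap.range B'.mulVecLin) :
    ∃ C : Matrix (Fin n) (Fin n) K, B = B' * C := by
  have hc : ∀ c, ∃ x, B'.mulVec x = B.mulVec (Pi.single c 1) := fun c => h ⟨_, rfl⟩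
  choose x hx using hc
  refine ⟨(Matrix.of x).transpose, ?_⟩
  ext r c
  have := congrFun (hx c) r
  rw [Matrix.mulVec_single_one] at this
  exact this.symm

/-- Two families of injective matrices have the same images if and only if they differ by the
action of `GL(α)`. -/
theorem toGrass_eq_iff {B B' : IHom K α W} :
    IHom.toGrass K α W B = IHom.toGrass K α W B' ↔
      ∃ g : GLα K α, ∀ i, (B i).1 = (B' i).1 * (g i).1 := by
  constructor
  · intro h
    have hr : ∀ i, LinearMap.range (B i).1.mulVecLin = LinearMap.range (B' i).1.mulVecLin :=
      fun i => congrArg Subtype.val (congrFun h i)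
    choose C hC using fun i => exists_eq_mul_of_range_le (hr i).le
    choose C' hC' using fun i => exists_eq_mul_of_range_le (hr i).ge
    have h1 : ∀ i, C' i * C i = 1 := by
      intro i
      refine Matrix.toLin'.injective (LinearMap.ext fun m => (B i).2 ?_)
      simp only [Matrix.toLin'_apply, Matrix.mulVecLin_apply, Matrix.mulVec_mulVec]
      rw [← Matrix.mul_assoc, ← hC', ← hC, Matrix.mul_one]
    exact ⟨fun i => ⟨C i, C' i, mul_eq_one_comm.mp (h1 i), h1 i⟩, hC⟩
  · rintro ⟨g, hg⟩
    refine funext fun i => Subtype.ext ?_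
    change LinearMap.range (B i).1.mulVecLin = LinearMap.range (B' i).1.mulVecLin
    rw [hg i, Matrix.mulVecLin_mul, LinearMap.range_comp_of_range_eq_top]
    refine LinearMap.range_eq_top.mpr fun m => ⟨(g i)⁻¹.1.mulVec m, ?_⟩
    rw [Matrix.mulVecLin_apply, Matrix.mulVec_mulVec, Units.mul_inv, Matrix.one_mulVec]

end Grassmannian

variable [Quiver.{h} V]

namespace FramedRep

/-- The matrix of the truncated canonical map. -/
def hatMatrix (p : FramedRep K α ζ) (i : V) : Matrix (extPaths K α ζ i) (Fin (α i)) K :=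
  Matrix.of fun σ => p.row σ.1

theorem mulVecLin_hatMatrix (p : FramedRep K α ζ) (i : V) :
    (p.hatMatrix i).mulVecLin = p.phiHat i :=
  LinearMap.ext fun m => funext fun σ => (p.phi_apply m σ.1).symm

theorem hatMatrix_smul (g : GLα K α) (p : FramedRep K α ζ) (i : V) :
    (g • p).hatMatrix i = p.hatMatrix i * (g i)⁻¹.1 := by
  refine funext fun σ => ?_
  rw [Matrix.mul_apply_eq_vecMul]
  exact p.row_smul g σ.1

end FramedRep

theorem FramedReg.hatMatrix {X : Type y} {T : FunSpace k K X} {φ : X → FramedRep K α ζ}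
    (hφ : FramedReg T φ) (i : V) : T.MatReg fun b => (φ b).hatMatrix i :=
  fun σ c => hφ.row σ.1 c

theorem EnumSkeleton.mem_extPaths (S : EnumSkeleton α ζ) {i : V} {σ : FramedPath ζ i}
    (hσ : σ ∈ S.set i) : σ ∈ extPaths K α ζ i :=
  Or.inl ⟨S.set, S.mem_skeleta, hσ⟩

/-- A path `f_{i q}` that acts by a nonzero row on some stable representation can be extended to a
skeleton of it. So if it occurs in no skeleton, it vanishes on all stable representations. -/
theorem row_base_eq_zero [Finite V] {p : FramedRep K α ζ} (hp : p.Stable) {i : V} {q : Fin (ζ i)}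
    (h : FramedPath.base i q ∉ extPaths K α ζ i) : p.row (FramedPath.base i q) = 0 := by
  classical
  by_contra hne
  have hc : FramedPath.Closed (Function.update (fun _ => ∅) i {FramedPath.base i q}) := by
    intro j l τ a hτ
    by_cases hl : l = i
    · subst hl
      rw [Function.update_self] at hτ
      exact (FramedPath.base_ne_comp q a τ hτ.symm).elim
    · simp [Function.update_of_ne hl] at hτ
  obtain ⟨𝔖, h𝔖, hsub⟩ := hp.exists_hasSkeleton hc fun j => by
    by_cases hj : j = i
    · subst hj
      rw [Function.update_self]
      exact LinearIndepOn.singleton hne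
    · rw [Function.update_of_ne hj]
      exact linearIndepOn_empty _ _
  exact h (Or.inl ⟨𝔖, ⟨p, h𝔖⟩, hsub i (by simp)⟩)

namespace EnumSkeleton

variable (S : EnumSkeleton α ζ)

/-- The square submatrix with the rows that belong to the skeleton. -/
def minor (B : IHom K α fun i => extPaths K α ζ i) (i : V) : Matrix (Fin (α i)) (Fin (α i)) K :=
  Matrix.of fun r => (B i).1 ⟨(S.enum i r).1, S.mem_extPaths (S.enum i r).2⟩

/-- The families of matrices whose minors at the skeleton are invertible. -/
def ihomChart : Set (IHom K α fun i => extPaths K α ζ i) := {B | ∀ i, (S.minor B i).det ≠ 0}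

theorem matReg_minor {X : Type y} {T : FunSpace k K X}
    {φ : X → IHom K α fun i => extPaths K α ζ i} (hφ : IsMorphism T (ihomSpace k K α _) φ) (i : V) :
    T.MatReg fun b => S.minor (φ b) i :=
  fun r c => (matReg_ihomSpace i).comp hφ ⟨(S.enum i r).1, S.mem_extPaths (S.enum i r).2⟩ c

theorem isOpen_ihomChart [Finite V] :
    IsOpen[(ihomSpace k K α fun i => extPaths K α ζ i).toTopologicalSpace] S.ihomChart := by
  let _ := (ihomSpace k K α fun i => extPaths K α ζ i).toTopologicalSpace
  rw [ihomChart, ofPred_forall]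
  exact isOpen_iInter_of_finite fun i => isLocal_ihomSpace.isOpen_ne_zero
    (MatReg.det fun r c => matReg_ihomSpace i _ c)

open Classical in
/-- The coordinates of the normal form of a family of matrices. The paths `f_{i q}` that do not
occur in any skeleton are given the coordinates `0`, see `row_base_eq_zero`. -/
def ihomCoords (B : IHom K α fun i => extPaths K α ζ i) (b : S.Index) : K :=
  if hb : b.2.1.1 ∈ extPaths K α ζ b.1 then
    Matrix.vecMul ((B b.1).1 ⟨_, hb⟩) (S.minor B b.1)⁻¹ b.2.2 else 0

theorem minor_eq_mul {B B' : IHom K α fun i => extPaths K α ζ i} {g : GLα K α}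
    (hg : ∀ i, (B i).1 = (B' i).1 * (g i).1) (i : V) : S.minor B i = S.minor B' i * (g i).1 := by
  refine funext fun r => ?_
  rw [Matrix.mul_apply_eq_vecMul]
  change (B i).1 _ = _
  rw [hg, Matrix.mul_apply_eq_vecMul]
  rfl

theorem ihomCoords_eq {B B' : IHom K α fun i => extPaths K α ζ i}
    (h : IHom.toGrass K α _ B = IHom.toGrass K α _ B') : S.ihomCoords B = S.ihomCoords B' := by
  obtain ⟨g, hg⟩ := toGrass_eq_iff.mp h
  funext b
  rw [ihomCoords, ihomCoords]
  split_ifs with hb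
  · rw [S.minor_eq_mul hg, hg, Matrix.mul_inv_rev, Matrix.mul_apply_eq_vecMul,
      Matrix.vecMul_vecMul, ← Matrix.mul_assoc,
      Matrix.mul_nonsing_inv _ (Matrix.isUnits_det_units _), Matrix.one_mul]
  · rfl

theorem preimage_image_ihomChart :
    IHom.toGrass K α _ ⁻¹' (IHom.toGrass K α _ '' S.ihomChart) = S.ihomChart (K := K) := by
  refine Subset.antisymm ?_ (subset_preimage_image _ _)
  rintro B ⟨B', hB', h⟩
  obtain ⟨g, hg⟩ := toGrass_eq_iff.mp h.symm
  intro i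
  rw [S.minor_eq_mul hg, Matrix.det_mul]
  exact mul_ne_zero (hB' i) (Matrix.isUnits_det_units _).ne_zero

theorem ihomCoords_mem_reg {X : Type y} {T : FunSpace k K X} (hT : T.IsLocal)
    {φ : X → IHom K α fun i => extPaths K α ζ i} (hφ : IsMorphism T (ihomSpace k K α _) φ)
    (h0 : ∀ y, φ y ∈ S.ihomChart) (b : S.Index) : (fun y => S.ihomCoords (φ y) b) ∈ T.reg univ := by
  simp only [ihomCoords]
  split_ifs with hb
  · exact (((matReg_ihomSpace b.1).comp hφ).mul
      ((S.matReg_minor hφ b.1).inv hT fun y => h0 y b.1)) ⟨_, hb⟩ b.2.2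
  · exact zero_mem _

variable (K) in
/-- The open subset of the product of Grassmannians on which the coordinates at the skeleton form
a basis of the linear forms. -/
def grassChart : Set (Grass K α fun i => extPaths K α ζ i) := IHom.toGrass K α _ '' S.ihomChart

/-- The retraction of the chart of the product of Grassmannians to the moduli space. -/
def retraction (z : S.grassChart K) : Moduli K α ζ :=
  quotMap K α ζ (S.stableNormalForm (S.ihomCoords z.2.choose))

theorem retraction_toGrass (B : IHom K α fun i => extPaths K α ζ i)
    (hB : IHom.toGrass K α _ B ∈ S.grassChart K) :
    S.retraction ⟨_, hB⟩ = quotMap K α ζ (S.stableNormalForm (S.ihomCoords B)) := by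
  rw [retraction, S.ihomCoords_eq hB.choose_spec.2]

end EnumSkeleton

section Embedding

variable [Finite V]

theorem injective_mulVecLin_hatMatrix {p : FramedRep K α ζ} (hp : p.Stable) (i : V) :
    Function.Injective (p.hatMatrix i).mulVecLin := by
  obtain ⟨S, hS⟩ := exists_enumSkeleton_of_stable hp
  intro m m' hm
  exact FramedRep.eq_of_dotProduct_row_eq (((p.hasSkeleton_iff _).mp hS).2.1 i)
    (fun σ hσ => S.mem_extPaths hσ) fun σ hσ => congrFun hm ⟨σ, hσ⟩

/-- The truncated canonical maps of a stable representation. -/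
def hatIHom (p : StableRep K α ζ) : IHom K α fun i => extPaths K α ζ i :=
  fun i => ⟨p.1.hatMatrix i, injective_mulVecLin_hatMatrix p.2 i⟩

variable (K α ζ) in
/-- The map from the moduli space to the product of Grassmannians. -/
def moduliToGrass : Moduli K α ζ → Grass K α fun i => extPaths K α ζ i :=
  Quotient.lift (fun p => IHom.toGrass K α _ (hatIHom p)) <| by
    intro p q hpq
    obtain ⟨g, hg⟩ := quotMap_eq_iff.mp (Quotient.sound hpq)
    refine toGrass_eq_iff.mpr ⟨g⁻¹, fun i => ?_⟩
    change p.1.hatMatrix i = _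
    rw [← hg, FramedRep.hatMatrix_smul]
    rfl

theorem moduliToGrass_quotMap (p : StableRep K α ζ) :
    moduliToGrass K α ζ (quotMap K α ζ p) = IHom.toGrass K α _ (hatIHom p) := rfl

theorem isMorphism_moduliToGrass :
    IsMorphism (moduliSpace K α ζ k) (grassSpace K α (fun i => extPaths K α ζ i) k)
      (moduliToGrass K α ζ) := by
  refine IsMorphism.of_quotient ((isMorphism_quotient (ihomSpace k K α _) _).comp
    (IsMorphism.codInduced (φ := hatIHom) (isLocal_stableSpace.isMorphism_affine ?_)))
  rintro ⟨i, σ, c⟩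
  exact framedReg_val.hatMatrix i σ c

namespace EnumSkeleton

variable (S : EnumSkeleton α ζ)

theorem minor_hatIHom (p : StableRep K α ζ) (i : V) :
    S.minor (hatIHom p) i = S.basisMatrix p.1 i := rfl

theorem hatIHom_mem_ihomChart {p : StableRep K α ζ} :
    hatIHom p ∈ S.ihomChart ↔ p ∈ chart S.set :=
  (S.hasSkeleton_iff_det p.1).symm

theorem ihomCoords_hatIHom (p : StableRep K α ζ) :
    S.ihomCoords (hatIHom p) = S.coords p.1 := by
  funext ⟨i, ⟨σ, hσ⟩, r⟩
  by_cases hb : σ ∈ extPaths K α ζ i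
  · rw [ihomCoords, dif_pos hb]
    rfl
  · rw [ihomCoords, dif_neg hb]
    obtain ⟨⟨q | ⟨j, a, s⟩, rfl⟩, -⟩ := hσ
    · change 0 = Matrix.vecMul (p.1.row (FramedPath.base i q)) _ r
      rw [row_base_eq_zero p.2 hb, Matrix.zero_vecMul]
      rfl
    · exact (hb (Or.inr ⟨j, a, _, ⟨S.set, S.mem_skeleta, (S.enum j s).2⟩, rfl⟩)).elim

theorem isOpen_grassChart :
    IsOpen[(grassSpace K α (fun i => extPaths K α ζ i) k).toTopologicalSpace] (S.grassChart K) := by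
  refine isOpen_coinduced.mpr ?_
  rw [grassChart, preimage_image_ihomChart]
  exact S.isOpen_ihomChart

theorem isMorphism_retraction :
    IsMorphism ((grassSpace K α (fun i => extPaths K α ζ i) k).sub (S.grassChart K))
      (moduliSpace K α ζ k) S.retraction := by
  refine IsMorphism.of_quotient_sub (S := ihomSpace k K α _) S.isOpen_ihomChart
    S.preimage_image_ihomChart ?_
  have heq : (fun B : S.ihomChart (K := K) =>
      S.retraction ⟨IHom.toGrass K α _ B.1, mem_image_of_mem _ B.2⟩) = fun B =>
        quotMap K α ζ (S.stableNormalForm (S.ihomCoords B.1)) :=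
    funext fun B => S.retraction_toGrass B.1 _
  have hT : ((ihomSpace k K α _).sub (S.ihomChart (K := K))).IsLocal := isLocal_ihomSpace.induced _
  have h := (isMorphism_quotient (stableSpace K α ζ k) (quotMap K α ζ)).comp
    (S.isMorphism_stableNormalForm hT
      (S.ihomCoords_mem_reg hT (isMorphism_induced _ _) fun B => B.2))
  exact heq ▸ h

theorem retraction_moduliToGrass (x : Moduli K α ζ) (hx : moduliToGrass K α ζ x ∈ S.grassChart K) :
    S.retraction ⟨_, hx⟩ = x := by
  obtain ⟨p, rfl⟩ := Quotient.exists_rep x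
  have hp : hatIHom p ∈ S.ihomChart := by
    rw [← S.preimage_image_ihomChart]
    exact hx
  exact (S.retraction_toGrass (hatIHom p) hx).trans (by
    rw [ihomCoords_hatIHom]
    exact S.quotMap_stableNormalForm (S.hatIHom_mem_ihomChart.mp hp))

/-- Membership in the image of the moduli space is expressed by equations: the family of matrices
has to agree, up to the change of basis that normalizes it, with the one of the representation in
normal form that has the same coordinates. -/
theorem toGrass_mem_range_iff {B : IHom K α fun i => extPaths K α ζ i} (hB : B ∈ S.ihomChart) :
    IHom.toGrass K α _ B ∈ range (moduliToGrass K α ζ) ↔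
      ∀ i, (S.normalForm (S.ihomCoords B)).hatMatrix i * S.minor B i = (B i).1 := by
  constructor
  · rintro ⟨x, hx⟩ i
    obtain ⟨p, rfl⟩ := Quotient.exists_rep x
    have hx : IHom.toGrass K α _ B = IHom.toGrass K α _ (hatIHom p) := hx.symm
    obtain ⟨g, hg⟩ := toGrass_eq_iff.mp hx
    have hp : p ∈ chart S.set := by
      rw [← S.hatIHom_mem_ihomChart, ← S.preimage_image_ihomChart]
      exact ⟨B, hB, hx⟩
    rw [S.ihomCoords_eq hx, ihomCoords_hatIHom, ← S.basisGL_smul hp, FramedRep.hatMatrix_smul,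
      S.minor_eq_mul hg, minor_hatIHom, ← S.basisGL_val hp, hg, ← Matrix.mul_assoc,
      Matrix.mul_assoc _ (S.basisGL hp i)⁻¹.1, Units.inv_mul, Matrix.mul_one]
    rfl
  · intro h
    refine ⟨quotMap K α ζ (S.stableNormalForm (S.ihomCoords B)), ?_⟩
    rw [moduliToGrass_quotMap]
    exact (toGrass_eq_iff.mpr
      ⟨fun i => Matrix.GeneralLinearGroup.mkOfDetNeZero _ (hB i), fun i => (h i).symm⟩).symm

theorem isOpen_grassChart_diff_range :
    IsOpen[(grassSpace K α (fun i => extPaths K α ζ i) k).toTopologicalSpace]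
      (S.grassChart K \ range (moduliToGrass K α ζ)) := by
  refine isOpen_coinduced.mpr ?_
  change IsOpen[(ihomSpace k K α _).toTopologicalSpace] _
  let T := (ihomSpace k K α _).sub (S.ihomChart (K := K))
  let _ := T.toTopologicalSpace
  have hT : T.IsLocal := isLocal_ihomSpace.induced _
  have hval : IsMorphism T (ihomSpace k K α _) Subtype.val := isMorphism_induced _ _
  let D (i : V) (B : S.ihomChart (K := K)) : Matrix (extPaths K α ζ i) (Fin (α i)) K :=
    (S.normalForm (S.ihomCoords B.1)).hatMatrix i * S.minor B.1 i
  have hD : ∀ i, T.MatReg (D i) := fun i => ((S.framedReg_normalForm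
    (S.ihomCoords_mem_reg hT hval fun B => B.2)).hatMatrix i).mul (S.matReg_minor hval i)
  have heq : IHom.toGrass K α _ ⁻¹' (S.grassChart K \ range (moduliToGrass K α ζ)) =
      Subtype.val '' ⋃ i, ⋃ σ, ⋃ c, {B : S.ihomChart (K := K) | D i B σ c - (B.1 i).1 σ c ≠ 0} := by
    rw [preimage_sdiff, grassChart, preimage_image_ihomChart]
    ext B
    simp only [mem_image, mem_iUnion, mem_sdiff, mem_preimage, mem_ofPred_eq, Subtype.exists,
      exists_and_right, exists_eq_right]
    refine exists_prop.symm.trans (exists_congr fun hB => ?_)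
    rw [S.toGrass_mem_range_iff hB]
    simp only [← Matrix.ext_iff, not_forall, sub_ne_zero, Subtype.exists]
    rfl
  rw [heq]
  refine isOpen_image_val S.isOpen_ihomChart (isOpen_iUnion fun i => isOpen_iUnion fun σ =>
    isOpen_iUnion fun c => hT.isOpen_ne_zero ?_)
  exact sub_mem (hD i σ c) ((matReg_ihomSpace i).comp hval σ c)

end EnumSkeleton

theorem exists_moduliToGrass_mem_grassChart (x : Moduli K α ζ) :
    ∃ S : EnumSkeleton α ζ, moduliToGrass K α ζ x ∈ S.grassChart K := by
  obtain ⟨p, rfl⟩ := Quotient.exists_rep x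
  obtain ⟨S, hS⟩ := exists_enumSkeleton_of_stable p.2
  exact ⟨S, hatIHom p, S.hatIHom_mem_ihomChart.mpr hS, rfl⟩

theorem injective_moduliToGrass : Function.Injective (moduliToGrass K α ζ) := by
  intro x y hxy
  obtain ⟨S, hS⟩ := exists_moduliToGrass_mem_grassChart x
  rw [← S.retraction_moduliToGrass x hS, ← S.retraction_moduliToGrass y (hxy ▸ hS)]
  congr 1
  exact Subtype.ext hxy

end Embedding

end

theorem theorem1 {k : Type u} {K : Type v} [Field k] [Field K] [Algebra k K]
    {V : Type w} [Quiver.{h} V] [Finite V] [∀ i j : V, Finite (i ⟶ j)] (α ζ : V → ℕ) :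
    ((skeleta K α ζ).Finite ∧
      (⋃ 𝔖 ∈ skeleta K α ζ, chart 𝔖) = (univ : Set (StableRep K α ζ)) ∧
      (⋃ 𝔖 ∈ skeleta K α ζ, quotMap K α ζ '' chart 𝔖) = univ ∧
      ∃ N : ℕ, ∀ 𝔖 ∈ skeleta K α ζ,
        IsOpen[(stableSpace K α ζ k).toTopologicalSpace] (chart 𝔖) ∧
        IsOpen[(moduliSpace K α ζ k).toTopologicalSpace] (quotMap K α ζ '' chart 𝔖) ∧
        ∃ (e : (chart 𝔖 : Set (StableRep K α ζ)) ≃ GLα K α × (Fin N → K))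
          (ebar : (quotMap K α ζ '' chart 𝔖 : Set (Moduli K α ζ)) ≃ (Fin N → K)),
          ((stableSpace K α ζ k).sub (chart 𝔖)).IsIso (glAffineSpace K α k N) e ∧
          ((moduliSpace K α ζ k).sub (quotMap K α ζ '' chart 𝔖)).IsIso
            (FunSpace.affine k K (Fin N)) ebar ∧
          (∀ (g g' : GLα K α) (c : Fin N → K),
            (e.symm (g * g', c)).1.1 = g • (e.symm (g', c)).1.1) ∧
          ∀ p : (chart 𝔖 : Set (StableRep K α ζ)),
            ebar ⟨quotMap K α ζ p.1, mem_image_of_mem _ p.2⟩ = (e p).2) ∧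
    ∃ (Y : Set (Grass K α fun i => extPaths K α ζ i)) (e : Moduli K α ζ ≃ Y),
      @IsLocallyClosed _ (grassSpace K α (fun i => extPaths K α ζ i) k).toTopologicalSpace Y ∧
      (moduliSpace K α ζ k).IsIso
        ((grassSpace K α (fun i => extPaths K α ζ i) k).sub Y) e ∧
      ∀ (p : StableRep K α ζ) (i : V),
        ((e (quotMap K α ζ p)).1 i).1 = LinearMap.range (p.1.phiHat i) := by
  refine ⟨⟨finite_skeleta, ?_, ?_, moduliDim α ζ, ?_⟩, range (moduliToGrass K α ζ),
    Equiv.ofInjective _ injective_moduliToGrass, ?_, ?_, ?_⟩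
  · refine eq_univ_of_forall fun p => ?_
    obtain ⟨S, hS⟩ := exists_enumSkeleton_of_stable p.2
    exact mem_iUnion₂.mpr ⟨S.set, S.mem_skeleta, hS⟩
  · refine eq_univ_of_forall fun x => ?_
    obtain ⟨p, rfl⟩ := Quotient.exists_rep x
    obtain ⟨S, hS⟩ := exists_enumSkeleton_of_stable p.2
    exact mem_iUnion₂.mpr ⟨S.set, S.mem_skeleta, p, hS, rfl⟩
  · intro 𝔖 h𝔖
    obtain ⟨S, rfl⟩ := exists_enumSkeleton h𝔖
    let ε := Finite.equivFinOfCardEq S.card_index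
    refine ⟨S.isOpen_chart, isOpen_coinduced.mpr ?_, S.chartEquiv ε, S.quotChartEquiv ε,
      S.isIso_chartEquiv ε, S.isIso_quotChartEquiv ε, fun g g' c => mul_smul g g' _,
      S.quotChartEquiv_quotMap ε⟩
    rw [S.preimage_image_chart]
    exact S.isOpen_chart
  · refine FunSpace.isLocallyClosed_of_cover (fun S : EnumSkeleton α ζ => S.grassChart K)
      (fun S => S.isOpen_grassChart) ?_ fun S => S.isOpen_grassChart_diff_range
    rintro _ ⟨x, rfl⟩
    exact exists_moduliToGrass_mem_grassChart x
  · exact FunSpace.IsMorphism.isIso_sub _ isMorphism_moduliToGrass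
      (fun S : EnumSkeleton α ζ => S.grassChart K) (fun S => S.isOpen_grassChart)
      exists_moduliToGrass_mem_grassChart (fun S => S.retraction)
      (fun S => S.isMorphism_retraction) fun S x hx => S.retraction_moduliToGrass x hx
  · intro p i
    change LinearMap.range (p.1.hatMatrix i).mulVecLin = _
    rw [FramedRep.mulVecLin_hatMatrix]
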